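/- **Setting.** Fix real numbers $\theta\neq 0$, $\Omega>0$, $\mu_0$, $M>1$. For $x,y\in\mathbb R^4$ put $x\theta^{-1}y=\frac2\theta(x_1y_2-x_2y_1+x_3y_4-x_4y_3)$. The sliced propagators are, for $u,v\in\mathbb R^4$, $$C^i(u,v)=\int_{I_i}\frac{\Omega\,d\alpha}{[2\pi\sinh\alpha]^2}\,e^{-\frac\Omega4\coth(\frac\alpha2)\|u\|^2-\frac\Omega4\tanh(\frac\alpha2)\|v\|^2-\frac{\mu_0^2}{\Omega}\alpha},$$ where $I_0=[1,\infty)$ and $I_i=[M^{-2i},M^{-2(i-1)}]$ for $i\ge1$. A graph $G$ has $n$ vertices, each bearing four cyclically ordered fields $(v,1),\dots,(v,4)$; some of the fields are joined in disjoint pairs by internal lines (tadpoles and multiple lines are allowed), and the remaining ones are the external fields. A scale assignment $\mu$ gives an integer $i_l\ge0$ to each internal line $l$. Given a test function $\varphi_f$ on $\mathbb R^4$ for each external field $f$, the amputated amplitude is $$A_{G,\mu}=\int\prod_{v,a}dx_{v,a}\prod_v\Big[\delta(x_{v,1}-x_{v,2}+x_{v,3}-x_{v,4})\,e^{i\sum_{a<b}(-1)^{a+b+1}x_{v,a}\theta^{-1}x_{v,b}}\Big]\prod_l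 C^{i_l}(u_l,v_l)\prod_{f\text{ external}}\varphi_f(x_f),$$ where $u_l$ and $v_l$ are the difference and the sum of the positions of the two ends of $l$. For $i\ge 0$ let $G^i_k$, $k=1,\dots,k(i)$, be the connected components of the subgraph formed by the lines of scale at least $i$, and let $N(G^i_k)$ be the number of fields at vertices of $G^i_k$ that are not ends of lines of $G^i_k$. Orient the fields of $G^i_k$ along a spanning tree as entering or exiting, alternately in the cyclic order around each vertex, in such a way that each tree line exits at one end and enters at the other. A line of $G^i_k$ that enters at both ends or exits at both ends is called clashing; $G^i_k$ is orientable if there is no clashing line, and non-orientable otherwise. Let $\omega(G^i_k)=N(G^i_k)-4$ if $G^i_k$ is orientable, and $\omega(G^i_k)=N(G^i_k)$ if it is non-orientable. **Lemma.** Let $\mathcal F$ be a bounded set (for instance a finite set) of Schwartz functions $\mathbb R^4\to\mathbb C$. There is a constant $K>0$, depending only on $\theta,\Omega,\mu_0,M,\mathcal F$, such that for every connected graph $G$ with at least one external field, with $n$ vertices, every scale assignment $\mu$ and every choice of test functions $\varphi_f\in\mathcal F$ for the external fields, the integral defining $A_{G,\mu}$ converges absolutely and $$|A_{G,\mu}|\le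 K^n\prod_{i\ge1}\prod_k M^{-\omega(G^i_k)} .$$ Moreover non-orientable components are irrelevant: $\omega(G^i_k)>0$ whenever $G^i_k$ is non-orientable. -/

import Mathlib

noncomputable section

namespace NCPhi

open MeasureTheory

/-- Four-dimensional Euclidean position space. -/
abbrev Pos : Type := EuclideanSpace ℝ (Fin 4)

/-- The symplectic pairing `x θ⁻¹ y = (2/θ) (x₁ y₂ - x₂ y₁ + x₃ y₄ - x₄ y₃)`. -/
def symp (θ : ℝ) (x y : Pos) : ℝ :=
  2 / θ * (x 0 * y 1 - x 1 * y 0 + x 2 * y 3 - x 3 * y 2)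

/-- The phase `exp (i ∑_{a<b} (-1)^{a+b+1} x_a θ⁻¹ x_b)` of a Moyal vertex; the four corners are
numbered from `0`, which does not change the parity of `a + b`. -/
def vertexPhase (θ : ℝ) (x : Fin 4 → Pos) : ℂ :=
  Complex.exp (Complex.I *
    ((∑ a : Fin 4, ∑ b : Fin 4,
      if a < b then (-1 : ℝ) ^ ((a : ℕ) + (b : ℕ) + 1) * symp θ (x a) (x b) else 0 : ℝ) : ℂ))

/-- The range of the parameter `α` in the slice of scale `i`: `[1, ∞)` for `i = 0` and
`[M^{-2i}, M^{-2(i-1)}]` for `i ≥ 1` (up to end points). -/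
def sliceRange (M : ℝ) : ℕ → Set ℝ
  | 0 => Set.Ioi 1
  | i + 1 => Set.Ioc ((M ^ (2 * (i + 1)))⁻¹) ((M ^ (2 * i))⁻¹)

/-- The propagator `C^i(u, v)` of scale `i` as a function of the short variable `u` and the
long variable `v`. -/
def propagator (Ω μ₀ M : ℝ) (i : ℕ) (u v : Pos) : ℝ :=
  ∫ α in sliceRange M i,
    Ω / (2 * Real.pi * Real.sinh α) ^ 2 *
      Real.exp (-(Ω / 4) * (Real.cosh (α / 2) / Real.sinh (α / 2)) * ‖u‖ ^ 2
        - (Ω / 4) * Real.tanh (α / 2) * ‖v‖ ^ 2 - μ₀ ^ 2 / Ω * α)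

/-- A graph with `n` four-valent vertices and `m` internal lines. A field (half-line) is a pair
`(v, a)` of a vertex and one of its four cyclically ordered corners; each internal line `l` joins
the two fields `src l` and `tgt l`, and no field belongs to two lines. Tadpoles and multiple lines
are allowed. The naming of the two ends is an arbitrary auxiliary choice. -/
structure Graph (n m : ℕ) where
  src : Fin m → Fin n × Fin 4
  tgt : Fin m → Fin n × Fin 4
  inj : Function.Injective (Sum.elim src tgt)

namespace Graph

variable {n m : ℕ} (G : Graph n m)

open Classical in
/-- The fields at the vertices of `W` that are not ends of a line of `S`, that is the external
fields of the subgraph with vertices `W` and lines `S`. -/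
def externalFields (W : Finset (Fin n)) (S : Finset (Fin m)) : Finset (Fin n × Fin 4) :=
  {f | f.1 ∈ W ∧ ∀ l ∈ S, G.src l ≠ f ∧ G.tgt l ≠ f}

/-- The simple graph on the vertices in which two different vertices are adjacent when a line
of `S` joins them. -/
def lineGraph (S : Finset (Fin m)) : SimpleGraph (Fin n) :=
  SimpleGraph.fromRel fun v w => ∃ l ∈ S, (G.src l).1 = v ∧ (G.tgt l).1 = w

/-- The graph is connected (in particular it has a vertex). -/
def Connected : Prop := (G.lineGraph Finset.univ).Connected

/-- `T` is a spanning tree of the subgraph with vertices `W` and lines `S`. -/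
def IsSpanningTree (W : Finset (Fin n)) (S T : Finset (Fin m)) : Prop :=
  T ⊆ S ∧ (∀ v ∈ W, ∀ w ∈ W, (G.lineGraph T).Reachable v w) ∧ T.card + 1 = W.card

/-- An orientation of all fields as entering (`true`) or exiting (`false`), alternating around
each vertex in the cyclic order. -/
def IsAlternating (ε : Fin n × Fin 4 → Bool) : Prop :=
  ∀ v : Fin n, ∀ a : Fin 4, ε (v, a + 1) = !ε (v, a)

/-- A line clashes when it enters at both ends or exits at both ends; otherwise it is
well-oriented. -/
def Clashing (ε : Fin n × Fin 4 → Bool) (l : Fin m) : Prop := ε (G.src l) = ε (G.tgt l)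

/-- The (connected) subgraph with vertices `W` and lines `S` is orientable: orienting the fields
along a spanning tree, so that the orientation alternates around the vertices and every tree line
exits at one end and enters at the other, leaves no clashing line. -/
def Orientable (W : Finset (Fin n)) (S : Finset (Fin m)) : Prop :=
  ∃ T : Finset (Fin m), G.IsSpanningTree W S T ∧
    ∃ ε : Fin n × Fin 4 → Bool, IsAlternating ε ∧ (∀ l ∈ T, ¬ G.Clashing ε l) ∧
      ∀ l ∈ S, ¬ G.Clashing ε l

/-- The lines of scale at least `i`, that is the lines of `G^i`. -/
def highLines (μ : Fin m → ℕ) (i : ℕ) : Finset (Fin m) := {l | i ≤ μ l}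

/-- The index set of the connected components `G^i_k` of `G^i`. A vertex without line in `G^i` is
a component by itself; it has four external fields, is orientable and has `ω = 0`. -/
abbrev Component (μ : Fin m → ℕ) (i : ℕ) : Type :=
  (G.lineGraph (highLines μ i)).ConnectedComponent

section Component

variable {G} {μ : Fin m → ℕ} {i : ℕ}

open Classical in
/-- The vertices of `G^i_k`. -/
def Component.vertices (k : G.Component μ i) : Finset (Fin n) := {v | v ∈ k.supp}

open Classical in
/-- The lines of `G^i_k`. -/
def Component.lines (k : G.Component μ i) : Finset (Fin m) :=
  {l | l ∈ highLines μ i ∧ (G.src l).1 ∈ k.supp}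

/-- `G^i_k` is orientable. -/
def Component.IsOrientable (k : G.Component μ i) : Prop := G.Orientable k.vertices k.lines

/-- The number `N(G^i_k)` of external fields of `G^i_k`. -/
def Component.N (k : G.Component μ i) : ℕ := (G.externalFields k.vertices k.lines).card

open Classical in
/-- The convergence degree: `N - 4` for an orientable component, `N` for a non-orientable one. -/
def Component.omega (k : G.Component μ i) : ℤ :=
  if k.IsOrientable then (k.N : ℤ) - 4 else (k.N : ℤ)

end Component

open Classical in
/-- The product over all scales `i ≥ 1` and all components `G^i_k` of `M^{-ω(G^i_k)}`. Scales above
the largest scale of a line contribute a factor `1`. -/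
def powerCounting (M : ℝ) (μ : Fin m → ℕ) : ℝ :=
  ∏ i ∈ Finset.Icc 1 (Finset.univ.sup μ), ∏ k : G.Component μ i, M ^ (-k.omega)

/-- All positions `x_{v,a}` as functions of the first three positions at each vertex, the last one
being given by `δ(x_{v,1} - x_{v,2} + x_{v,3} - x_{v,4})`. -/
def positions (y : Fin n → Fin 3 → Pos) (v : Fin n) : Fin 4 → Pos :=
  ![y v 0, y v 1, y v 2, y v 0 - y v 1 + y v 2]

/-- The external fields of the whole graph. -/
abbrev externals : Finset (Fin n × Fin 4) := G.externalFields Finset.univ Finset.univ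

/-- The integrand of the amplitude at the positions `x`, without the `δ` functions: vertex
phases, sliced propagators on the internal lines, test functions at the external fields. -/
def integrand (θ Ω μ₀ M : ℝ) (μ : Fin m → ℕ) (φ : Fin n × Fin 4 → SchwartzMap Pos ℂ)
    (x : Fin n → Fin 4 → Pos) : ℂ :=
  (∏ v, vertexPhase θ (x v)) *
  (∏ l, (propagator Ω μ₀ M (μ l)
    (x (G.src l).1 (G.src l).2 - x (G.tgt l).1 (G.tgt l).2)
    (x (G.src l).1 (G.src l).2 + x (G.tgt l).1 (G.tgt l).2) : ℂ)) *
  ∏ f ∈ G.externals, φ f (x f.1 f.2)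

/-- The amputated amplitude `A_{G,μ}` with the external arguments integrated against the test
functions `φ`. The integral of `∏_v δ(x_{v,1} - x_{v,2} + x_{v,3} - x_{v,4}) F(x)` over all
positions is the integral of `F` over the first three positions at each vertex. -/
def amplitude (θ Ω μ₀ M : ℝ) (μ : Fin m → ℕ) (φ : Fin n × Fin 4 → SchwartzMap Pos ℂ) : ℂ :=
  ∫ y : Fin n → Fin 3 → Pos, G.integrand θ Ω μ₀ M μ φ (positions y)

end Graph

end NCPhi

end

namespace NCPhi
open MeasureTheory

/-! No oscillation is needed: the vertex phases have modulus one and are discarded. A propagator of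
scale `i` is at most a constant times `M ^ (2 i)` times a Gaussian of width `M ^ (-i)` in the short
variable and one of width `M ^ i` in the long variable (`exists_propagator_bound`). The integrand is
thus dominated by a product of `4 n` bounded functions, each of one linear form in the `3 n`
independent positions: a short and a long form per line, and a position per external field.

Integrate `3 n` independent forms and bound the other factors by constants. The forms have integer
coefficients, so the Jacobian determinant is a nonzero integer and costs nothing
(`integral_prod_intForms_le`). In dimension four a chosen short form of scale `i` yields `M ^ (-4
i)`, a chosen long one `M ^ (4 i)`. All short forms can be kept (`linearIndependent_short`), so the
aim is to choose few long forms of high scale. A greedy choice, taking short forms, then external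
positions and long forms by increasing scale, does this (`exists_good_forms`).

For `i ≥ 1`, the number of chosen long forms of scale at least `i` is then the dimension of the
common kernel of the forms chosen from before that scale. On this kernel the two ends of each line
agree, external positions and lines of scale below `i` vanish, and the vertex constraints remain: it
embeds in the kernel of a signed incidence matrix of the high lines (`finrank_ker_forms_le`). The
transposed kernel consists of vertex functions that flip sign along lines, up to the corner signs.
It has at most one dimension per orientable component, and none from the others. Rank-nullity turns
this into the degree `ω`, the `-4` of an orientable component being that one dimension in each of
four coordinates. -/

/-! ### Gaussian bounds on the sliced propagators and decay of the test functions. -/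

theorem mul_min_le_tanh_half {α : ℝ} (hα : 0 < α) :
    (2 * Real.cosh (1 / 2))⁻¹ * min α 1 ≤ Real.tanh (α / 2) := by
  have h1 := Real.cosh_pos (1 / 2)
  have h2 := Real.cosh_pos (α / 2)
  rw [Real.tanh_eq_sinh_div_cosh]
  rcases le_total α 1 with h | h
  · rw [min_eq_left h, inv_mul_eq_div, div_le_div_iff₀ (by positivity) h2]
    have h3 : α / 2 ≤ Real.sinh (α / 2) := Real.self_le_sinh_iff.2 (by positivity)
    have h4 : Real.cosh (α / 2) ≤ Real.cosh (1 / 2) := by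
      rw [Real.cosh_le_cosh, abs_of_pos (by positivity), abs_of_pos (by positivity)]; linarith
    nlinarith
  · rw [min_eq_right h, mul_one, inv_eq_one_div, div_le_div_iff₀ (by positivity) h2]
    have h3 : (1 / 2 : ℝ) ≤ Real.sinh (1 / 2) := Real.self_le_sinh_iff.2 (by positivity)
    have h4 : 0 ≤ Real.sinh (α / 2 - 1 / 2) := Real.sinh_nonneg_iff.2 (by linarith)
    rw [Real.sinh_sub] at h4
    nlinarith

/-- After clearing denominators this follows from `exp (-α) ≥ 1 - α`. -/
theorem inv_le_coth_half {α : ℝ} (hα : 0 < α) :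
    α⁻¹ ≤ Real.cosh (α / 2) / Real.sinh (α / 2) := by
  have h1 : 0 < Real.sinh (α / 2) := Real.sinh_pos_iff.2 (by positivity)
  rw [inv_eq_one_div, div_le_div_iff₀ hα h1, Real.cosh_eq, Real.sinh_eq]
  have h2 : Real.exp (-(α / 2)) = Real.exp (α / 2) * Real.exp (-α) := by
    rw [← Real.exp_add]; congr 1; ring
  have h3 := Real.add_one_le_exp (-α)
  have h4 := Real.exp_pos (α / 2)
  have h5 := Real.exp_pos (-(α / 2))
  nlinarith

theorem one_le_coth_half {α : ℝ} (hα : 0 < α) :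
    1 ≤ Real.cosh (α / 2) / Real.sinh (α / 2) := by
  have h1 : 0 < Real.sinh (α / 2) := Real.sinh_pos_iff.2 (by positivity)
  rw [one_le_div h1]
  exact (Real.sinh_lt_cosh _).le

theorem sliceRange_subset_Ioi {M : ℝ} (i : ℕ) :
    sliceRange M i ⊆ Set.Ioi (M ^ (2 * i))⁻¹ := by
  cases i with
  | zero => simp [sliceRange]
  | succ i => exact Set.Ioc_subset_Ioi_self

theorem measurableSet_sliceRange (M : ℝ) (i : ℕ) : MeasurableSet (sliceRange M i) := by
  cases i with
  | zero => exact measurableSet_Ioi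
  | succ i => exact measurableSet_Ioc

theorem le_coth_half_of_mem_sliceRange {M α : ℝ} (hM : 1 < M) {i : ℕ} (hα : α ∈ sliceRange M i) :
    (M ^ 2)⁻¹ * M ^ (2 * i) ≤ Real.cosh (α / 2) / Real.sinh (α / 2) := by
  have hM0 : 0 < M := by linarith
  have h0 : 0 < α := lt_trans (by positivity) (sliceRange_subset_Ioi i hα)
  cases i with
  | zero =>
    refine le_trans ?_ (one_le_coth_half h0)
    simpa using inv_le_one_of_one_le₀ (one_le_pow₀ hM.le)
  -- The upper end of the slice is `M ^ (-2 i)` for scale `i + 1`, which costs the factor `M ^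
  -- (-2)`.
  | succ i =>
    refine le_trans ?_ (inv_le_coth_half h0)
    have h1 : α ≤ (M ^ (2 * i))⁻¹ := hα.2
    rw [le_inv_comm₀ (by positivity) h0]
    refine h1.trans_eq ?_
    rw [mul_add, pow_add]; field_simp

theorem le_tanh_half_of_mem_sliceRange {M α : ℝ} (hM : 1 < M) {i : ℕ} (hα : α ∈ sliceRange M i) :
    (2 * Real.cosh (1 / 2))⁻¹ * (M ^ (2 * i))⁻¹ ≤ Real.tanh (α / 2) := by
  have hM0 : 0 < M := by linarith
  have h0 : (M ^ (2 * i))⁻¹ < α := sliceRange_subset_Ioi i hα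
  have h1 := Real.cosh_pos (1 / 2)
  refine le_trans ?_ (mul_min_le_tanh_half (lt_trans (by positivity) h0))
  gcongr
  exact le_min h0.le (inv_le_one_of_one_le₀ (one_le_pow₀ hM.le))

/-- The propagator of scale `i` is bounded by `M ^ (2 i)` times a Gaussian of width `M ^ (-i)` in
the short variable and a Gaussian of width `M ^ i` in the long variable. -/
theorem exists_propagator_bound (Ω μ₀ M : ℝ) (hΩ : 0 < Ω) (hM : 1 < M) :
    ∃ C c : ℝ, 0 < C ∧ 0 < c ∧ ∀ (i : ℕ) (u v : Pos), 0 ≤ propagator Ω μ₀ M i u v ∧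
      propagator Ω μ₀ M i u v ≤ C * M ^ (2 * i) *
        (Real.exp (-(c * M ^ (2 * i)) * ‖u‖ ^ 2) * Real.exp (-(c * (M ^ (2 * i))⁻¹) * ‖v‖ ^ 2)) := by
  have hM0 : 0 < M := by linarith
  have hch := Real.cosh_pos (1 / 2)
  set c : ℝ := Ω / 4 * min (M ^ 2)⁻¹ (2 * Real.cosh (1 / 2))⁻¹ with hc
  refine ⟨Ω / (2 * Real.pi) ^ 2, c, by positivity, by positivity, fun i u v => ?_⟩
  have hnn : ∀ α, 0 ≤ Ω / (2 * Real.pi * Real.sinh α) ^ 2 *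
      Real.exp (-(Ω / 4) * (Real.cosh (α / 2) / Real.sinh (α / 2)) * ‖u‖ ^ 2
        - (Ω / 4) * Real.tanh (α / 2) * ‖v‖ ^ 2 - μ₀ ^ 2 / Ω * α) := fun α => by positivity
  refine ⟨integral_nonneg hnn, ?_⟩
  set E : ℝ := Real.exp (-(c * M ^ (2 * i)) * ‖u‖ ^ 2) *
    Real.exp (-(c * (M ^ (2 * i))⁻¹) * ‖v‖ ^ 2) with hE
  have hE0 : 0 < E := by positivity
  set a : ℝ := (M ^ (2 * i))⁻¹ with ha
  have ha0 : 0 < a := by positivity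
  have hint : IntegrableOn (fun α : ℝ => α ^ (-2 : ℝ)) (Set.Ioi a) :=
    integrableOn_Ioi_rpow_of_lt (by norm_num) ha0
  -- The prefactor is at most a multiple of `α ^ (-2)` because `sinh α ≥ α`; its integral beyond the
  -- lower end of the slice is the source of `M ^ (2 i)`.
  have hval : ∫ α in Set.Ioi a, α ^ (-2 : ℝ) = M ^ (2 * i) := by
    rw [integral_Ioi_rpow_of_lt (by norm_num) ha0]
    norm_num
    rw [Real.rpow_neg_one, ha, inv_inv]
  have hpt : ∀ α ∈ sliceRange M i, Ω / (2 * Real.pi * Real.sinh α) ^ 2 *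
      Real.exp (-(Ω / 4) * (Real.cosh (α / 2) / Real.sinh (α / 2)) * ‖u‖ ^ 2
        - (Ω / 4) * Real.tanh (α / 2) * ‖v‖ ^ 2 - μ₀ ^ 2 / Ω * α)
      ≤ Ω / (2 * Real.pi) ^ 2 * E * α ^ (-2 : ℝ) := by
    intro α hα
    have hα0 : 0 < α := lt_trans ha0 (sliceRange_subset_Ioi i hα)
    have h1 := le_coth_half_of_mem_sliceRange hM hα
    have h2 := le_tanh_half_of_mem_sliceRange hM hα
    have h3 : α ≤ Real.sinh α := Real.self_le_sinh_iff.2 hα0.le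
    have h4 : Ω / (2 * Real.pi * Real.sinh α) ^ 2 ≤ Ω / (2 * Real.pi) ^ 2 * α ^ (-2 : ℝ) := by
      have : α ^ (-2 : ℝ) = (α ^ 2)⁻¹ := by
        rw [Real.rpow_neg hα0.le]; norm_cast
      rw [this, ← div_eq_mul_inv, div_div, ← mul_pow]
      gcongr
    have h5 : Real.exp (-(Ω / 4) * (Real.cosh (α / 2) / Real.sinh (α / 2)) * ‖u‖ ^ 2
        - (Ω / 4) * Real.tanh (α / 2) * ‖v‖ ^ 2 - μ₀ ^ 2 / Ω * α) ≤ E := by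
      rw [hE, ← Real.exp_add, Real.exp_le_exp]
      have h6 : c * M ^ (2 * i) ≤ Ω / 4 * (Real.cosh (α / 2) / Real.sinh (α / 2)) := by
        rw [hc, mul_assoc]
        refine mul_le_mul_of_nonneg_left (le_trans ?_ h1) (by positivity)
        exact mul_le_mul_of_nonneg_right (min_le_left _ _) (by positivity)
      have h7 : c * a ≤ Ω / 4 * Real.tanh (α / 2) := by
        rw [hc, mul_assoc]
        refine mul_le_mul_of_nonneg_left (le_trans ?_ h2) (by positivity)
        exact mul_le_mul_of_nonneg_right (min_le_right _ _) (by positivity)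
      have h8 : 0 ≤ μ₀ ^ 2 / Ω * α := by positivity
      have h9 := mul_le_mul_of_nonneg_right h6 (sq_nonneg ‖u‖)
      have h10 := mul_le_mul_of_nonneg_right h7 (sq_nonneg ‖v‖)
      linarith
    calc _ ≤ Ω / (2 * Real.pi) ^ 2 * α ^ (-2 : ℝ) * E := by gcongr
      _ = _ := by ring
  calc propagator Ω μ₀ M i u v
      ≤ ∫ α in sliceRange M i, Ω / (2 * Real.pi) ^ 2 * E * α ^ (-2 : ℝ) := by
        refine integral_mono_of_nonneg (ae_of_all _ hnn)
          ((hint.mono_set (sliceRange_subset_Ioi i)).const_mul _) ?_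
        exact (ae_restrict_iff' (measurableSet_sliceRange M i)).2 (ae_of_all _ hpt)
    _ = Ω / (2 * Real.pi) ^ 2 * E * ∫ α in sliceRange M i, α ^ (-2 : ℝ) := integral_const_mul _ _
    _ ≤ Ω / (2 * Real.pi) ^ 2 * E * ∫ α in Set.Ioi a, α ^ (-2 : ℝ) := by
        refine mul_le_mul_of_nonneg_left ?_ (by positivity)
        refine setIntegral_mono_set hint ?_ (sliceRange_subset_Ioi i).eventuallyLE
        refine (ae_restrict_iff' measurableSet_Ioi).2 (ae_of_all _ fun α hα => ?_)
        exact Real.rpow_nonneg (ha0.trans hα).le _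
    _ = _ := by rw [hval]; ring

theorem measurable_propagator (Ω μ₀ M : ℝ) (i : ℕ) :
    Measurable fun p : Pos × Pos => propagator Ω μ₀ M i p.1 p.2 := by
  refine (StronglyMeasurable.integral_prod_right ?_).measurable
  refine Measurable.stronglyMeasurable ?_
  unfold Function.uncurry
  simp only [Real.tanh_eq_sinh_div_cosh]
  fun_prop

/-- The functions of a bounded set of Schwartz functions have a common integrable majorant. -/
theorem exists_schwartz_bound (𝓕 : Set (SchwartzMap Pos ℂ)) (h𝓕 : Bornology.IsVonNBounded ℝ 𝓕) :
    ∃ C : ℝ, 0 < C ∧ ∀ φ ∈ 𝓕, ∀ x, ‖φ x‖ ≤ C * (1 + ‖x‖) ^ (-5 : ℝ) := by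
  obtain ⟨r, hr, h⟩ := ((schwartz_withSeminorms ℝ Pos ℂ).isVonNBounded_iff_finset_seminorm_bounded.1
    h𝓕) (Finset.Iic (5, 0))
  -- Decay of order five is integrable in dimension four.
  refine ⟨2 ^ 5 * r, by positivity, fun φ hφ x => ?_⟩
  have h1 := SchwartzMap.one_add_le_sup_seminorm_apply (𝕜 := ℝ) (m := (5, 0)) (k := 5) (n := 0)
    le_rfl le_rfl φ x
  rw [norm_iteratedFDeriv_zero] at h1
  have h2 : (0 : ℝ) < 1 + ‖x‖ := by positivity
  rw [Real.rpow_neg h2.le, ← div_eq_mul_inv, le_div_iff₀ (by positivity), mul_comm]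
  norm_cast at h1 ⊢
  refine h1.trans ?_
  gcongr
  exact (h φ hφ).le

theorem integrable_gaussian {b : ℝ} (hb : 0 < b) :
    Integrable fun x : Pos => Real.exp (-b * ‖x‖ ^ 2) := by
  -- A non-integrable function has integral `0` by convention, whereas the Gaussian formula gives a
  -- positive value.
  by_contra h
  have h1 := GaussianFourier.integral_rexp_neg_mul_sq_norm (V := Pos) hb
  rw [integral_undef h] at h1
  have : 0 < (Real.pi / b) ^ (Module.finrank ℝ Pos / 2 : ℝ) := by positivity
  linarith

theorem integral_gaussian_four {b : ℝ} (hb : 0 < b) :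
    ∫ x : Pos, Real.exp (-b * ‖x‖ ^ 2) = (Real.pi / b) ^ 2 := by
  rw [GaussianFourier.integral_rexp_neg_mul_sq_norm (V := Pos) hb]
  rw [finrank_euclideanSpace_fin, ← Real.rpow_natCast]
  norm_num

/-! ### Integer linear changes of variables. -/

/-- Coordinates of a family of positions. -/
def coordEquiv (n : ℕ) : (Fin n → Fin 3 → Pos) ≃ₗ[ℝ] ((Fin n × Fin 3) × Fin 4 → ℝ) where
  toFun y p := y p.1.1 p.1.2 p.2
  invFun z v a := WithLp.toLp 2 fun i => z ((v, a), i)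
  map_add' _ _ := rfl
  map_smul' _ _ := rfl
  left_inv _ := rfl
  right_inv _ := rfl

theorem coordEquiv_apply {n : ℕ} (y : Fin n → Fin 3 → Pos) (p : (Fin n × Fin 3) × Fin 4) :
    coordEquiv n y p = y p.1.1 p.1.2 p.2 := rfl

theorem coordEquiv_symm_apply {n : ℕ} (z : (Fin n × Fin 3) × Fin 4 → ℝ) (v : Fin n) (a : Fin 3)
    (i : Fin 4) : (coordEquiv n).symm z v a i = z ((v, a), i) := rfl

/-- The linear map on families of positions given by a matrix of integers. -/
def intMap {n : ℕ} (A : Matrix (Fin n × Fin 3) (Fin n × Fin 3) ℤ) :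
    (Fin n → Fin 3 → Pos) →ₗ[ℝ] (Fin n → Fin 3 → Pos) where
  toFun y v a := ∑ j, A (v, a) j • y j.1 j.2
  map_add' y z := by ext; simp [Finset.sum_add_distrib]
  map_smul' r y := by
    ext v a
    simp [Finset.mul_sum]

/-- The matrix acts identically on the four coordinates, hence as a Kronecker product with the
identity. -/
theorem det_intMap {n : ℕ} (A : Matrix (Fin n × Fin 3) (Fin n × Fin 3) ℤ) :
    LinearMap.det (intMap A) = ((A.det ^ 4 : ℤ) : ℝ) := by
  have h : (coordEquiv n : _ →ₗ[ℝ] _) ∘ₗ intMap A ∘ₗ ((coordEquiv n).symm : _ →ₗ[ℝ] _) =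
      Matrix.toLin' (Matrix.kroneckerMap (fun x y => x * y) (A.map (Int.cast : ℤ → ℝ))
        (1 : Matrix (Fin 4) (Fin 4) ℝ)) := by
    refine LinearMap.ext fun z => funext fun ⟨⟨v, a⟩, i⟩ => ?_
    simp only [LinearMap.comp_apply, LinearEquiv.coe_coe, Matrix.toLin'_apply, Matrix.mulVec,
      dotProduct, Matrix.kroneckerMap_apply, Matrix.map_apply]
    rw [Fintype.sum_prod_type]
    simp [coordEquiv_apply, coordEquiv_symm_apply, intMap, Matrix.one_apply]
  rw [← LinearMap.det_conj _ (coordEquiv n), h, LinearMap.det_toLin', Matrix.det_kronecker]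
  have := (Int.castRingHom ℝ).map_det A
  simp only [Matrix.det_one, one_pow, mul_one, Fintype.card_fin]
  rw [show A.map (Int.cast : ℤ → ℝ) = (Int.castRingHom ℝ).mapMatrix A from rfl, ← this]
  simp

/-- Products of integrable functions of independent integral linear forms are integrable, and
the change of variables does not increase the integral. -/
theorem integral_prod_intForms_le {n : ℕ} (A : Matrix (Fin n × Fin 3) (Fin n × Fin 3) ℤ)
    (hA : A.det ≠ 0) (g : Fin n × Fin 3 → Pos → ℝ) (hg : ∀ j, Integrable (g j))
    (hg0 : ∀ j x, 0 ≤ g j x) :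
    Integrable (fun y : Fin n → Fin 3 → Pos => ∏ p, g p (∑ j, A p j • y j.1 j.2)) ∧
      ∫ y : Fin n → Fin 3 → Pos, ∏ p, g p (∑ j, A p j • y j.1 j.2) ≤ ∏ p, ∫ x, g p x := by
  set F : (Fin n → Fin 3 → Pos) → ℝ := fun y => ∏ v, ∏ a, g (v, a) (y v a) with hF
  have hFint : Integrable F := by
    refine Integrable.fintype_prod (f := fun v (y : Fin 3 → Pos) => ∏ a, g (v, a) (y a)) fun v => ?_
    exact Integrable.fintype_prod (f := fun a => g (v, a)) fun a => hg (v, a)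
  have hFval : ∫ y, F y = ∏ p, ∫ x, g p x := by
    rw [Fintype.prod_prod_type, hF]
    rw [integral_fintype_prod_volume_eq_prod (fun v (y : Fin 3 → Pos) => ∏ a, g (v, a) (y a))]
    exact Finset.prod_congr rfl fun v _ =>
      integral_fintype_prod_volume_eq_prod (fun a => g (v, a))
  have heq : (fun y : Fin n → Fin 3 → Pos => ∏ p, g p (∑ j, A p j • y j.1 j.2)) =
      F ∘ intMap A := by
    funext y
    simp [hF, Fintype.prod_prod_type, intMap]
  have hdet : LinearMap.det (intMap A) ≠ 0 := by
    rw [det_intMap]; exact_mod_cast pow_ne_zero 4 hA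
  -- A nonzero integer has absolute value at least one, so the inverse Jacobian is at most one,
  -- uniformly in the graph.
  have hone : 1 ≤ |LinearMap.det (intMap A)| := by
    rw [det_intMap]
    exact_mod_cast Int.one_le_abs (pow_ne_zero 4 hA)
  have : (volume : Measure (Fin 3 → Pos)).IsAddHaarMeasure :=
    Measure.pi.isAddHaarMeasure fun _ => volume
  have : (volume : Measure (Fin n → Fin 3 → Pos)).IsAddHaarMeasure :=
    Measure.pi.isAddHaarMeasure fun _ => volume
  have hmap := Measure.map_linearMap_addHaar_eq_smul_addHaar
    (volume : Measure (Fin n → Fin 3 → Pos)) hdet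
  have hmeas : Measurable (intMap A) := (LinearMap.continuous_of_finiteDimensional _).measurable
  have hFmap : Integrable F (Measure.map (intMap A) volume) := by
    rw [hmap]; exact hFint.smul_measure ENNReal.ofReal_ne_top
  rw [heq]
  refine ⟨(integrable_map_measure hFmap.1 hmeas.aemeasurable).1 hFmap, ?_⟩
  have h1 : ∫ y, (F ∘ intMap A) y = ∫ y, F y ∂(Measure.map (intMap A) volume) :=
    (integral_map hmeas.aemeasurable hFmap.1).symm
  rw [h1, hmap, integral_smul_measure, hFval, ENNReal.toReal_ofReal (abs_nonneg _), abs_inv,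
    smul_eq_mul]
  refine mul_le_of_le_one_left ?_ (inv_le_one_of_one_le₀ hone)
  exact Finset.prod_nonneg fun p _ => integral_nonneg (hg0 p)

/-! ### Combinatorics of the components: field counting, spanning trees, orientability. -/

namespace Graph

variable {n m : ℕ} (G : Graph n m)

section Lines

theorem src_injective : Function.Injective G.src := fun a b h =>
  Sum.inl_injective (G.inj (a₁ := Sum.inl a) (a₂ := Sum.inl b) h)

theorem tgt_injective : Function.Injective G.tgt := fun a b h =>
  Sum.inr_injective (G.inj (a₁ := Sum.inr a) (a₂ := Sum.inr b) h)

theorem src_ne_tgt (a b : Fin m) : G.src a ≠ G.tgt b := fun h =>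
  Sum.inl_ne_inr (G.inj (a₁ := Sum.inl a) (a₂ := Sum.inr b) h)

variable {G}

theorem mem_externalFields {W : Finset (Fin n)} {S : Finset (Fin m)} {f : Fin n × Fin 4} :
    f ∈ G.externalFields W S ↔ f.1 ∈ W ∧ ∀ l ∈ S, G.src l ≠ f ∧ G.tgt l ≠ f := by
  simp [externalFields]

theorem lineGraph_mono {S T : Finset (Fin m)} (h : S ⊆ T) : G.lineGraph S ≤ G.lineGraph T := by
  intro v w hvw
  simp only [lineGraph, SimpleGraph.fromRel_adj] at hvw ⊢
  refine ⟨hvw.1, hvw.2.imp ?_ ?_⟩ <;> exact fun ⟨l, hl, h'⟩ => ⟨l, h hl, h'⟩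

theorem reachable_of_mem {S : Finset (Fin m)} {l : Fin m} (hl : l ∈ S) :
    (G.lineGraph S).Reachable (G.src l).1 (G.tgt l).1 := by
  by_cases h : (G.src l).1 = (G.tgt l).1
  · rw [h]
  · refine SimpleGraph.Adj.reachable ?_
    exact ⟨h, Or.inl ⟨l, hl, rfl, rfl⟩⟩

/-- Used to propagate absolute values, and membership in a component, along lines. -/
theorem eq_of_reachable {α : Type*} {S : Finset (Fin m)} (D : Fin n → α)
    (hD : ∀ l ∈ S, D (G.src l).1 = D (G.tgt l).1) {v w : Fin n}
    (h : (G.lineGraph S).Reachable v w) : D v = D w := by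
  obtain ⟨p⟩ := h
  induction p with
  | nil => rfl
  | cons hadj _ ih =>
    refine Eq.trans ?_ ih
    rcases hadj.2 with ⟨l, hl, rfl, rfl⟩ | ⟨l, hl, rfl, rfl⟩
    · exact hD l hl
    · exact (hD l hl).symm

/-- Every field of a closed subgraph is external or one end of one line. -/
theorem two_mul_card_add_card_externalFields {W : Finset (Fin n)} {S : Finset (Fin m)}
    (hS : ∀ l ∈ S, (G.src l).1 ∈ W ∧ (G.tgt l).1 ∈ W) :
    2 * S.card + (G.externalFields W S).card = 4 * W.card := by
  classical
  have h1 : W ×ˢ (Finset.univ : Finset (Fin 4)) =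
      (S.image G.src ∪ S.image G.tgt) ∪ G.externalFields W S := by
    ext f
    simp only [Finset.mem_product, Finset.mem_univ, and_true, Finset.mem_union, Finset.mem_image,
      mem_externalFields]
    constructor
    · intro hf
      by_cases h : ∃ l ∈ S, G.src l = f ∨ G.tgt l = f
      · obtain ⟨l, hl, h | h⟩ := h
        · exact Or.inl (Or.inl ⟨l, hl, h⟩)
        · exact Or.inl (Or.inr ⟨l, hl, h⟩)
      · push Not at h
        exact Or.inr ⟨hf, h⟩
    · rintro ((⟨l, hl, rfl⟩ | ⟨l, hl, rfl⟩) | h)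
      · exact (hS l hl).1
      · exact (hS l hl).2
      · exact h.1
  have h2 : Disjoint (S.image G.src) (S.image G.tgt) := by
    rw [Finset.disjoint_left]
    intro f h h'
    obtain ⟨a, -, rfl⟩ := Finset.mem_image.1 h
    obtain ⟨b, -, hb⟩ := Finset.mem_image.1 h'
    exact G.src_ne_tgt a b hb.symm
  have h3 : Disjoint (S.image G.src ∪ S.image G.tgt) (G.externalFields W S) := by
    rw [Finset.disjoint_left]
    intro f h h'
    rw [mem_externalFields] at h'
    rcases Finset.mem_union.1 h with h | h <;> obtain ⟨a, ha, rfl⟩ := Finset.mem_image.1 h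
    · exact (h'.2 a ha).1 rfl
    · exact (h'.2 a ha).2 rfl
  have h4 := congrArg Finset.card h1
  rw [Finset.card_union_of_disjoint h3, Finset.card_union_of_disjoint h2,
    Finset.card_image_of_injective _ G.src_injective,
    Finset.card_image_of_injective _ G.tgt_injective, Finset.card_product, Finset.card_univ,
    Fintype.card_fin] at h4
  omega

end Lines

section Component

variable {G} {μ : Fin m → ℕ} {i : ℕ}

theorem mem_highLines {l : Fin m} : l ∈ highLines μ i ↔ i ≤ μ l := by simp [highLines]

theorem Component.mem_vertices {k : G.Component μ i} {v : Fin n} :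
    v ∈ k.vertices ↔ (G.lineGraph (highLines μ i)).connectedComponentMk v = k := by
  simp [Component.vertices]

theorem Component.mem_lines {k : G.Component μ i} {l : Fin m} :
    l ∈ k.lines ↔ l ∈ highLines μ i ∧ (G.src l).1 ∈ k.vertices := by
  simp [Component.lines, Component.vertices]

theorem mk_src_eq_mk_tgt {l : Fin m} (hl : l ∈ highLines μ i) :
    (G.lineGraph (highLines μ i)).connectedComponentMk (G.src l).1 =
      (G.lineGraph (highLines μ i)).connectedComponentMk (G.tgt l).1 :=
  SimpleGraph.ConnectedComponent.sound (reachable_of_mem hl)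

theorem Component.src_tgt_mem {k : G.Component μ i} {l : Fin m} (hl : l ∈ k.lines) :
    (G.src l).1 ∈ k.vertices ∧ (G.tgt l).1 ∈ k.vertices := by
  rw [Component.mem_lines] at hl
  refine ⟨hl.2, ?_⟩
  rw [Component.mem_vertices, ← mk_src_eq_mk_tgt hl.1]
  exact Component.mem_vertices.1 hl.2

theorem Component.card_lines_add_N (k : G.Component μ i) :
    2 * k.lines.card + k.N = 4 * k.vertices.card :=
  two_mul_card_add_card_externalFields fun _ hl => k.src_tgt_mem hl

open Classical in
theorem sum_card_vertices : ∑ k : G.Component μ i, k.vertices.card = n := by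
  have h := Finset.card_eq_sum_card_fiberwise
    (f := (G.lineGraph (highLines μ i)).connectedComponentMk)
    (s := Finset.univ) (t := Finset.univ) (fun _ _ => Finset.mem_coe.2 (Finset.mem_univ _))
  rw [Finset.card_univ, Fintype.card_fin] at h
  refine Eq.trans ?_ h.symm
  refine Finset.sum_congr rfl fun k _ => congrArg Finset.card ?_
  ext v
  simp [Component.mem_vertices]

open Classical in
theorem sum_card_lines : ∑ k : G.Component μ i, k.lines.card = (highLines μ i).card := by
  have h := Finset.card_eq_sum_card_fiberwise
    (f := fun l => (G.lineGraph (highLines μ i)).connectedComponentMk (G.src l).1)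
    (s := highLines μ i) (t := Finset.univ) (fun _ _ => Finset.mem_coe.2 (Finset.mem_univ _))
  rw [h]
  refine Finset.sum_congr rfl fun k _ => congrArg Finset.card ?_
  ext l
  simp [Component.mem_vertices, Component.mem_lines]

-- Counting the fields of a component gives `N = 4 |vertices| - 2 |lines|`, isolated vertices
-- included; the vertices, and the lines of scale at least `i`, are partitioned by the components.
open Classical in
theorem sum_omega : ∑ k : G.Component μ i, k.omega =
    4 * n - 2 * (highLines μ i).card -
      4 * (Finset.univ.filter fun k : G.Component μ i => k.IsOrientable).card := by
  have h : ∀ k : G.Component μ i, k.omega =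
      4 * (k.vertices.card : ℤ) - 2 * (k.lines.card : ℤ) - 4 * (if k.IsOrientable then 1 else 0) := by
    intro k
    have := k.card_lines_add_N
    unfold Component.omega
    split_ifs <;> omega
  rw [Finset.sum_congr rfl fun k _ => h k, Finset.sum_sub_distrib, Finset.sum_sub_distrib,
    ← Finset.mul_sum, ← Finset.mul_sum, ← Finset.mul_sum, Finset.sum_boole]
  congr 3
  · exact_mod_cast sum_card_vertices
  · exact_mod_cast sum_card_lines

/-- A subtree of a component can be grown one line at a time. -/
theorem Component.exists_subtree (k : G.Component μ i) {r : Fin n} (hr : r ∈ k.vertices) (s : ℕ)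
    (hs : s + 1 ≤ k.vertices.card) :
    ∃ W ⊆ k.vertices, ∃ T ⊆ k.lines, r ∈ W ∧ W.card = s + 1 ∧ T.card = s ∧
      (∀ l ∈ T, (G.src l).1 ∈ W ∧ (G.tgt l).1 ∈ W) ∧ ∀ w ∈ W, (G.lineGraph T).Reachable r w := by
  classical
  induction s with
  | zero =>
    exact ⟨{r}, by simpa using hr, ∅, by simp, by simp, by simp, by simp, by simp, by simp⟩
  | succ s ih =>
    obtain ⟨W, hW, T, hT, hrW, hWc, hTc, hTW, hreach⟩ := ih (by omega)
    obtain ⟨w, hw, hwW⟩ : ∃ w ∈ k.vertices, w ∉ W :=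
      Finset.exists_mem_notMem_of_card_lt_card (by omega)
    obtain ⟨p⟩ : (G.lineGraph (highLines μ i)).Reachable r w := by
      rw [← SimpleGraph.ConnectedComponent.eq, Component.mem_vertices.1 hr,
        Component.mem_vertices.1 hw]
    -- A walk from the root to a missing vertex leaves `W` somewhere; the line crossing there
    -- extends the tree.
    obtain ⟨d, -, hd1, hd2⟩ := p.exists_boundary_dart (W : Set (Fin n)) hrW hwW
    simp only [Finset.mem_coe] at hd1 hd2
    obtain ⟨l, hl, hends⟩ : ∃ l ∈ highLines μ i,
        ((G.src l).1 = d.fst ∧ (G.tgt l).1 = d.snd) ∨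
          ((G.src l).1 = d.snd ∧ (G.tgt l).1 = d.fst) := by
      rcases d.adj.2 with ⟨l, hl, h⟩ | ⟨l, hl, h⟩
      · exact ⟨l, hl, Or.inl h⟩
      · exact ⟨l, hl, Or.inr h⟩
    have hlk : l ∈ k.lines := by
      refine Component.mem_lines.2 ⟨hl, ?_⟩
      rcases hends with h | h
      · rw [h.1]; exact hW hd1
      · rw [Component.mem_vertices, mk_src_eq_mk_tgt hl, h.2]
        exact Component.mem_vertices.1 (hW hd1)
    have hsnd : d.snd ∈ k.vertices := by
      have := k.src_tgt_mem hlk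
      rcases hends with h | h
      · rw [← h.2]; exact this.2
      · rw [← h.1]; exact this.1
    have hlT : l ∉ T := fun h => by
      have := hTW l h
      rcases hends with h' | h'
      · exact hd2 (h'.2 ▸ this.2)
      · exact hd2 (h'.1 ▸ this.1)
    have hmono := lineGraph_mono (G := G) (Finset.subset_insert l T)
    refine ⟨insert d.snd W, Finset.insert_subset hsnd hW, insert l T, Finset.insert_subset hlk hT,
      Finset.mem_insert_of_mem hrW, by rw [Finset.card_insert_of_notMem hd2, hWc],
      by rw [Finset.card_insert_of_notMem hlT, hTc], ?_, ?_⟩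
    · intro l' hl'
      rcases Finset.mem_insert.1 hl' with rfl | hl'
      · rcases hends with h | h <;> rw [h.1, h.2] <;> simp [hd1]
      · exact (hTW l' hl').imp Finset.mem_insert_of_mem Finset.mem_insert_of_mem
    · intro w' hw'
      rcases Finset.mem_insert.1 hw' with rfl | hw'
      · refine ((hreach _ hd1).mono hmono).trans ?_
        have h1 := reachable_of_mem (G := G) (Finset.mem_insert_self l T)
        rcases hends with h | h
        · rwa [h.1, h.2] at h1
        · rw [h.1, h.2] at h1; exact h1.symm
      · exact (hreach _ hw').mono hmono

theorem Component.exists_isSpanningTree (k : G.Component μ i) :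
    ∃ T, G.IsSpanningTree k.vertices k.lines T := by
  obtain ⟨r, hr⟩ := k.nonempty_supp
  have hr' : r ∈ k.vertices := Component.mem_vertices.2 hr
  have hpos : 0 < k.vertices.card := Finset.card_pos.2 ⟨r, hr'⟩
  obtain ⟨W, hW, T, hT, -, hWc, hTc, -, hreach⟩ :=
    k.exists_subtree hr' (k.vertices.card - 1) (by omega)
  have hWeq : W = k.vertices := Finset.eq_of_subset_of_card_le hW (by omega)
  subst hWeq
  exact ⟨T, hT, fun v hv w hw => (hreach v hv).symm.trans (hreach w hw), by omega⟩

/-- A component of a connected graph with an external field has an external field. -/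
theorem Component.N_pos (hG : G.Connected) (hext : G.externals.Nonempty) (k : G.Component μ i) :
    0 < k.N := by
  rw [Component.N, Finset.card_pos]
  by_contra hempty
  rw [Finset.not_nonempty_iff_eq_empty] at hempty
  have hends : ∀ f : Fin n × Fin 4, f.1 ∈ k.vertices → ∃ l ∈ k.lines, G.src l = f ∨ G.tgt l = f := by
    intro f hf
    by_contra h
    push Not at h
    have : f ∈ G.externalFields k.vertices k.lines := mem_externalFields.2 ⟨hf, h⟩
    rw [hempty] at this
    simp at this
  obtain ⟨r, hr⟩ := k.nonempty_supp
  have hr' : r ∈ k.vertices := Component.mem_vertices.2 hr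
  obtain ⟨e, he⟩ := hext
  -- Without external fields no line of the whole graph can leave the component, so by connectedness
  -- it contains the vertex of the external field `e`.
  have hD : ∀ l ∈ (Finset.univ : Finset (Fin m)),
      ((G.src l).1 ∈ k.vertices) = ((G.tgt l).1 ∈ k.vertices) := by
    intro l _
    refine propext ⟨fun h => ?_, fun h => ?_⟩
    · obtain ⟨l', hl', h' | h'⟩ := hends _ h
      · rw [G.src_injective h'] at hl'
        exact (k.src_tgt_mem hl').2
      · exact absurd h'.symm (G.src_ne_tgt _ _)
    · obtain ⟨l', hl', h' | h'⟩ := hends _ h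
      · exact absurd h' (G.src_ne_tgt _ _)
      · rw [G.tgt_injective h'] at hl'
        exact (k.src_tgt_mem hl').1
  have heq := eq_of_reachable (fun v => v ∈ k.vertices) hD (hG.preconnected r e.1)
  obtain ⟨l, -, hl⟩ := hends e (heq ▸ hr')
  have := (mem_externalFields.1 he).2 l (Finset.mem_univ l)
  exact hl.elim this.1 this.2

/-- Non-orientable components are irrelevant. -/
theorem Component.omega_pos (hG : G.Connected) (hext : G.externals.Nonempty) (k : G.Component μ i)
    (hk : ¬ k.IsOrientable) : 0 < k.omega := by
  rw [Component.omega, if_neg hk]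
  exact_mod_cast k.N_pos hG hext

/-- A nowhere vanishing function on the vertices of a component that changes sign along each line,
up to the alternating signs of the corners, orients the component. -/
theorem Component.isOrientable_of_signs (k : G.Component μ i) (d : Fin n → ℝ)
    (hd : ∀ l ∈ k.lines, (-1 : ℝ) ^ ((G.src l).2 : ℕ) * d (G.src l).1 +
      (-1 : ℝ) ^ ((G.tgt l).2 : ℕ) * d (G.tgt l).1 = 0)
    (hd0 : ∀ v ∈ k.vertices, d v ≠ 0) : k.IsOrientable := by
  classical
  obtain ⟨T, hT⟩ := k.exists_isSpanningTree
  -- Where `d v ≠ 0`, the field `(v, a)` enters exactly when `(-1) ^ a * d v` is negative; the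
  -- hypothesis says that this sign flips along each line.
  set ε : Fin n × Fin 4 → Bool :=
    fun f => xor (decide ((f.2 : ℕ) % 2 = 0)) (decide (0 < d f.1)) with hε
  have hno : ∀ l ∈ k.lines, ¬ G.Clashing ε l := by
    intro l hl
    have h1 := hd l hl
    have h2 := hd0 _ (k.src_tgt_mem hl).1
    unfold Clashing
    rw [hε]
    generalize G.src l = f at *
    generalize G.tgt l = g at *
    obtain ⟨v, a⟩ := f
    obtain ⟨w, b⟩ := g
    rcases lt_or_gt_of_ne h2 with h2 | h2 <;> fin_cases a <;> fin_cases b <;>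
      norm_num at h1 h2 ⊢ <;> grind
  refine ⟨T, hT, ε, ?_, fun l hl => hno l (hT.1 hl), hno⟩
  intro v a
  fin_cases a <;> simp [hε]

end Component

end Graph

/-! ### Linear algebra of the choice of forms. -/

/-- Greedy choice of a maximal independent subfamily, in the order of increasing weight. -/
theorem exists_greedy_linearIndepOn {ι K V : Type*} [Finite ι] [Field K] [AddCommGroup V]
    [Module K V] (v : ι → V) (w : ι → ℕ) (h0 : LinearIndepOn K v {i | w i = 0}) :
    ∃ b : Set ι, LinearIndepOn K v b ∧ {i | w i = 0} ⊆ b ∧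
      ∀ s, Submodule.span K (v '' (b ∩ {i | w i ≤ s})) = Submodule.span K (v '' {i | w i ≤ s}) := by
  have key : ∀ t : ℕ, ∃ b : Set ι, b ⊆ {i | w i ≤ t} ∧ LinearIndepOn K v b ∧ {i | w i = 0} ⊆ b ∧
      ∀ s ≤ t, v '' {i | w i ≤ s} ⊆ Submodule.span K (v '' (b ∩ {i | w i ≤ s})) := by
    intro t
    induction t with
    | zero =>
      refine ⟨{i | w i = 0}, fun i hi => by simpa using hi, h0, subset_rfl, fun s hs => ?_⟩
      obtain rfl : s = 0 := by omega
      simp only [Nat.le_zero, Set.inter_self]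
      exact Submodule.subset_span
    | succ t ih =>
      obtain ⟨b, hb, hli, h0b, hspan⟩ := ih
      -- The family is only enlarged, so the spanning property at lower levels persists.
      obtain ⟨b', hb', hbb', hsp', hli'⟩ := exists_linearIndepOn_extension hli
        (t := {i | w i ≤ t + 1}) (fun i hi => Nat.le_succ_of_le (hb hi))
      refine ⟨b', hb', hli', h0b.trans hbb', fun s hs => ?_⟩
      rcases Nat.lt_or_ge t s with hs' | hs'
      · obtain rfl : s = t + 1 := by omega
        rwa [Set.inter_eq_left.2 hb']
      · refine (hspan s hs').trans ?_
        exact Submodule.span_mono (Set.image_mono (Set.inter_subset_inter_left _ hbb'))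
  obtain ⟨t, ht⟩ : ∃ t, ∀ i, w i ≤ t := by
    obtain ⟨t, ht⟩ := (Set.finite_range w).bddAbove
    exact ⟨t, fun i => ht ⟨i, rfl⟩⟩
  obtain ⟨b, -, hli, h0b, hspan⟩ := key t
  refine ⟨b, hli, h0b, fun s => le_antisymm
    (Submodule.span_mono (Set.image_mono Set.inter_subset_right)) (Submodule.span_le.2 ?_)⟩
  rcases le_total s t with h | h
  · exact hspan s h
  · have h1 : {i | w i ≤ s} = {i | w i ≤ t} := by
      ext i
      exact ⟨fun _ => ht i, fun _ => (ht i).trans h⟩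
    rw [h1]
    exact hspan t le_rfl

/-- The dimension of the space spanned by linear forms and of their common kernel. -/
theorem finrank_span_add_finrank_ker {ι κ : Type*} [Finite ι] [Fintype κ] (v : ι → κ → ℝ)
    (s : Set ι) :
    Module.finrank ℝ (Submodule.span ℝ (v '' s)) +
      Module.finrank ℝ (Matrix.of fun i : s => v i).mulVecLin.ker = Fintype.card κ := by
  classical
  have h1 := Matrix.rank_eq_finrank_span_row (Matrix.of fun i : s => v i)
  have h2 : Set.range (Matrix.of fun i : s => v i).row = v '' s := by
    rw [Set.image_eq_range]
    rfl
  rw [h2] at h1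
  rw [← h1, Matrix.rank, LinearMap.finrank_range_add_finrank_ker, Module.finrank_fintype_fun_eq_card]

/-- The coefficients of the position `x_{v,a}` with respect to the first three positions at each
vertex. -/
def posCoeff {n : ℕ} (f : Fin n × Fin 4) (j : Fin n × Fin 3) : ℤ :=
  if j.1 = f.1 then
    (![![1, 0, 0], ![0, 1, 0], ![0, 0, 1], ![1, -1, 1]] : Fin 4 → Fin 3 → ℤ) f.2 j.2
  else 0

theorem sum_posCoeff_smul {n : ℕ} {E : Type*} [AddCommGroup E] (f : Fin n × Fin 4)
    (y : Fin n × Fin 3 → E) :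
    ∑ j, posCoeff f j • y j =
      (![y (f.1, 0), y (f.1, 1), y (f.1, 2), y (f.1, 0) - y (f.1, 1) + y (f.1, 2)] :
        Fin 4 → E) f.2 := by
  obtain ⟨v, a⟩ := f
  rw [Fintype.sum_prod_type, Finset.sum_eq_single v]
  · fin_cases a <;> simp [posCoeff, Fin.sum_univ_three, sub_eq_add_neg]
  · intro w _ hw
    simp [posCoeff, hw]
  · simp

/-- The position `x_f` as a linear form in the real case. -/
def posForm {n : ℕ} (y : Fin n × Fin 3 → ℝ) (f : Fin n × Fin 4) : ℝ :=
  ∑ j, (posCoeff f j : ℝ) * y j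

theorem posForm_eq {n : ℕ} (y : Fin n × Fin 3 → ℝ) (f : Fin n × Fin 4) :
    posForm y f = (![y (f.1, 0), y (f.1, 1), y (f.1, 2), y (f.1, 0) - y (f.1, 1) + y (f.1, 2)] :
        Fin 4 → ℝ) f.2 := by
  rw [← sum_posCoeff_smul]
  simp [posForm]

theorem eq_zero_of_posForm {n : ℕ} {y : Fin n × Fin 3 → ℝ} (h : ∀ f, posForm y f = 0) : y = 0 := by
  funext ⟨v, a⟩
  have h0 := h (v, 0)
  have h1 := h (v, 1)
  have h2 := h (v, 2)
  rw [posForm_eq] at h0 h1 h2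
  fin_cases a
  · exact h0
  · exact h1
  · exact h2

/-- This is the `δ` constraint at a vertex, the only relation among its four corners. -/
theorem sum_alternating_posForm {n : ℕ} (y : Fin n × Fin 3 → ℝ) (v : Fin n) :
    ∑ a : Fin 4, (-1 : ℝ) ^ (a : ℕ) * posForm y (v, a) = 0 := by
  simp only [posForm_eq, Fin.sum_univ_four]
  simp
  ring

/-! ### The linear forms of the integrand and independence of the short variables. -/

namespace Graph

variable {n m : ℕ} (G : Graph n m)

/-- Indices of the linear forms in the integrand: short variables, long variables and external
positions. -/
abbrev Form : Type := Fin m ⊕ (Fin m ⊕ {f // f ∈ G.externals})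

/-- The integer coefficients of the linear forms in the integrand. -/
def formCoeff : G.Form → Fin n × Fin 3 → ℤ
  | .inl l => posCoeff (G.src l) - posCoeff (G.tgt l)
  | .inr (.inl l) => posCoeff (G.src l) + posCoeff (G.tgt l)
  | .inr (.inr f) => posCoeff f.1

/-- The coefficients of the linear forms as real vectors. -/
def formVec (p : G.Form) (j : Fin n × Fin 3) : ℝ := G.formCoeff p j

/-- The order in which the forms are chosen. -/
def formWeight (μ : Fin m → ℕ) : G.Form → ℕ
  | .inl _ => 0
  | .inr (.inl l) => μ l + 1
  | .inr (.inr _) => 1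

theorem card_form : Fintype.card G.Form = 4 * n := by
  have h := two_mul_card_add_card_externalFields (G := G) (W := Finset.univ) (S := Finset.univ)
    (fun _ _ => ⟨Finset.mem_univ _, Finset.mem_univ _⟩)
  rw [Finset.card_univ, Finset.card_univ, Fintype.card_fin, Fintype.card_fin] at h
  change 2 * m + G.externals.card = 4 * n at h
  rw [Fintype.card_sum, Fintype.card_sum, Fintype.card_coe, Fintype.card_fin]
  omega

/-- The value at a field of a combination of line ends, with sign `s` at the targets. -/
def endSum (s : ℝ) (c : Fin m → ℝ) (f : Fin n × Fin 4) : ℝ :=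
  ∑ l, c l * ((if G.src l = f then 1 else 0) + s * (if G.tgt l = f then 1 else 0))

theorem endSum_src (s : ℝ) (c : Fin m → ℝ) (l : Fin m) : G.endSum s c (G.src l) = c l := by
  rw [endSum, Finset.sum_eq_single l]
  · simp [(G.src_ne_tgt _ _).symm]
  · intro l' _ h
    simp [(G.src_ne_tgt _ _).symm, G.src_injective.ne h]
  · simp

theorem endSum_tgt (s : ℝ) (c : Fin m → ℝ) (l : Fin m) : G.endSum s c (G.tgt l) = s * c l := by
  rw [endSum, Finset.sum_eq_single l]
  · simp [G.src_ne_tgt, mul_comm]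
  · intro l' _ h
    simp [G.src_ne_tgt, G.tgt_injective.ne h]
  · simp

theorem endSum_external (s : ℝ) (c : Fin m → ℝ) {f : Fin n × Fin 4} (hf : f ∈ G.externals) :
    G.endSum s c f = 0 := by
  have h := (mem_externalFields.1 hf).2
  exact Finset.sum_eq_zero fun l hl => by simp [(h l hl).1, (h l hl).2]

theorem sum_endSum_mul (s : ℝ) (c : Fin m → ℝ) (p : Fin n × Fin 4 → ℝ) :
    ∑ f, G.endSum s c f * p f = ∑ l, c l * (p (G.src l) + s * p (G.tgt l)) := by
  simp only [endSum, Finset.sum_mul]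
  rw [Finset.sum_comm]
  refine Finset.sum_congr rfl fun l _ => ?_
  simp only [mul_assoc, ← Finset.mul_sum, add_mul, Finset.sum_add_distrib]
  simp

variable {G}

theorem field_cases (f : Fin n × Fin 4) :
    (∃ l, G.src l = f) ∨ (∃ l, G.tgt l = f) ∨ f ∈ G.externals := by
  by_contra h
  push Not at h
  exact h.2.2 (mem_externalFields.2 ⟨Finset.mem_univ _, fun l _ => ⟨h.1 l, h.2.1 l⟩⟩)

/-- The short variables of a connected graph with an external field are independent. -/
theorem linearIndependent_short (hG : G.Connected) (hext : G.externals.Nonempty) :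
    LinearIndependent ℝ fun l : Fin m => G.formVec (.inl l) := by
  rw [Fintype.linearIndependent_iff]
  intro c hc
  -- `w f` is the total coefficient of the position `x_f` in the relation.
  set w := G.endSum (-1) c with hw
  have hzero : ∀ j, ∑ f, w f * (posCoeff f j : ℝ) = 0 := by
    intro j
    rw [hw, sum_endSum_mul]
    have := congrFun hc j
    simp only [Finset.sum_apply, Pi.smul_apply, smul_eq_mul, Pi.zero_apply, formVec, formCoeff,
      Pi.sub_apply, Int.cast_sub] at this
    rw [← this]
    exact Finset.sum_congr rfl fun l _ => by ring
  have hvert : ∀ (v : Fin n) (b : Fin 3), ∑ a : Fin 4, w (v, a) *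
      (((![![1, 0, 0], ![0, 1, 0], ![0, 0, 1], ![1, -1, 1]] : Fin 4 → Fin 3 → ℤ) a b : ℤ) : ℝ)
      = 0 := by
    intro v b
    rw [← hzero (v, b), Fintype.sum_prod_type, Finset.sum_eq_single v]
    · simp [posCoeff]
    · intro v' _ h
      simp [posCoeff, h.symm]
    · simp
  -- A relation among the four corners is a multiple of `(1, -1, 1, -1)`. Hence `|w|` is constant at
  -- each vertex, and along lines, and it vanishes at the external field.
  have habs : ∀ (v : Fin n) (a : Fin 4), |w (v, a)| = |w (v, 3)| := by
    intro v a
    have h0 := hvert v 0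
    have h1 := hvert v 1
    have h2 := hvert v 2
    simp [Fin.sum_univ_four] at h0 h1 h2
    fin_cases a
    · rw [show w (v, 3) = - w (v, 0) by linarith, abs_neg]; rfl
    · rw [show w (v, 3) = w (v, 1) by linarith]; rfl
    · rw [show w (v, 3) = - w (v, 2) by linarith, abs_neg]; rfl
    · rfl
  have hline : ∀ l ∈ (Finset.univ : Finset (Fin m)),
      |w ((G.src l).1, 3)| = |w ((G.tgt l).1, 3)| := by
    intro l _
    rw [← habs _ (G.src l).2, ← habs _ (G.tgt l).2, hw]
    simp [endSum_src, endSum_tgt]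
  obtain ⟨e, he⟩ := hext
  intro l
  have h1 : |w ((G.src l).1, 3)| = |w (e.1, 3)| :=
    eq_of_reachable (fun v => |w (v, 3)|) hline (hG.preconnected (G.src l).1 e.1)
  rw [← habs _ (G.src l).2, ← habs _ e.2] at h1
  simpa [hw, endSum_src, G.endSum_external (-1) c he] using h1

/-! ### Counting dimensions with the signed incidence matrix. -/

variable (μ : Fin m → ℕ) (i : ℕ)

/-- The signed incidence matrix of the lines of scale at least `i`. -/
def incidence (G : Graph n m) (μ : Fin m → ℕ) (i : ℕ) :
    Matrix (Fin n) {l // l ∈ highLines μ i} ℝ :=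
  fun v l => (if (G.src l).1 = v then (-1 : ℝ) ^ ((G.src l).2 : ℕ) else 0) +
    (if (G.tgt l).1 = v then (-1 : ℝ) ^ ((G.tgt l).2 : ℕ) else 0)

theorem incidence_transpose_mulVec (d : Fin n → ℝ) (l : {l // l ∈ highLines μ i}) :
    ((G.incidence μ i).transpose.mulVec d) l =
      (-1 : ℝ) ^ ((G.src l).2 : ℕ) * d (G.src l).1 +
        (-1 : ℝ) ^ ((G.tgt l).2 : ℕ) * d (G.tgt l).1 := by
  simp [Matrix.mulVec, dotProduct, incidence, add_mul, Finset.sum_add_distrib]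

-- An element of the kernel has constant absolute value on each component. Where it is nonzero its
-- signs orient the component, so its values at one representative of each orientable component
-- determine it.
open Classical in
theorem finrank_ker_incidence_transpose_le :
    Module.finrank ℝ (G.incidence μ i).transpose.mulVecLin.ker ≤
      (Finset.univ.filter fun k : G.Component μ i => k.IsOrientable).card := by
  set O := {k : G.Component μ i // k.IsOrientable}
  have hout : ∀ k : G.Component μ i,
      (G.lineGraph (highLines μ i)).connectedComponentMk (Quot.out k) = k := fun k => Quot.out_eq k
  let ev : (Fin n → ℝ) →ₗ[ℝ] (O → ℝ) :=
    LinearMap.pi fun k => LinearMap.proj (Quot.out k.1)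
  have hinj : Function.Injective (ev ∘ₗ (G.incidence μ i).transpose.mulVecLin.ker.subtype) := by
    rw [← LinearMap.ker_eq_bot, LinearMap.ker_eq_bot']
    rintro ⟨d, hd⟩ hev
    have hd' : ∀ l ∈ highLines μ i, (-1 : ℝ) ^ ((G.src l).2 : ℕ) * d (G.src l).1 +
        (-1 : ℝ) ^ ((G.tgt l).2 : ℕ) * d (G.tgt l).1 = 0 := by
      intro l hl
      rw [← incidence_transpose_mulVec μ i d ⟨l, hl⟩]
      exact congrFun (LinearMap.mem_ker.1 hd) _
    have habs : ∀ l ∈ highLines μ i, |d (G.src l).1| = |d (G.tgt l).1| := by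
      intro l hl
      have h1 := congrArg abs (eq_neg_of_add_eq_zero_left (hd' l hl))
      simpa [abs_mul] using h1
    ext v
    by_contra hv
    have hv' : d v ≠ 0 := hv
    set k : G.Component μ i := (G.lineGraph (highLines μ i)).connectedComponentMk v with hk
    have hconst : ∀ w, (G.lineGraph (highLines μ i)).connectedComponentMk w = k →
        |d w| = |d v| := fun w hw =>
      eq_of_reachable (fun v => |d v|) habs (SimpleGraph.ConnectedComponent.exact hw)
    have hor : k.IsOrientable := by
      refine k.isOrientable_of_signs d
        (fun l hl => hd' l (Component.mem_lines.1 hl).1) fun w hw => ?_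
      have := hconst w (Component.mem_vertices.1 hw)
      intro h
      rw [h, abs_zero] at this
      exact hv' (abs_eq_zero.1 this.symm)
    have h1 := hconst _ (hout k)
    have h2 : d (Quot.out k) = 0 := congrFun hev ⟨k, hor⟩
    rw [h2, abs_zero] at h1
    exact hv' (abs_eq_zero.1 h1.symm)
  have h := LinearMap.finrank_le_finrank_of_injective hinj
  rwa [Module.finrank_fintype_fun_eq_card, Fintype.card_subtype] at h

-- Rank-nullity for the matrix and its transpose, which have the same rank.
open Classical in
theorem card_add_finrank_ker_incidence_le :
    n + Module.finrank ℝ (G.incidence μ i).mulVecLin.ker ≤ (highLines μ i).card +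
      (Finset.univ.filter fun k : G.Component μ i => k.IsOrientable).card := by
  have h1 := LinearMap.finrank_range_add_finrank_ker (G.incidence μ i).mulVecLin
  have h2 := LinearMap.finrank_range_add_finrank_ker (G.incidence μ i).transpose.mulVecLin
  have h3 := Matrix.rank_transpose (G.incidence μ i)
  have h4 := finrank_ker_incidence_transpose_le (G := G) μ i
  simp only [Matrix.rank] at h3
  rw [Module.finrank_fintype_fun_eq_card] at h1 h2
  rw [Fintype.card_coe] at h1
  rw [Fintype.card_fin] at h2
  omega

theorem formVec_mulVec_short (y : Fin n × Fin 3 → ℝ) (l : Fin m) :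
    ∑ j, G.formVec (.inl l) j * y j = posForm y (G.src l) - posForm y (G.tgt l) := by
  simp [formVec, formCoeff, posForm, sub_mul, Finset.sum_sub_distrib]

theorem formVec_mulVec_long (y : Fin n × Fin 3 → ℝ) (l : Fin m) :
    ∑ j, G.formVec (.inr (.inl l)) j * y j = posForm y (G.src l) + posForm y (G.tgt l) := by
  simp [formVec, formCoeff, posForm, add_mul, Finset.sum_add_distrib]

/-- On the left-hand kernel a configuration is determined by its values on the lines of scale at
least `i`, and there the vertex constraints are the incidence equations. The bound `1 ≤ i` admits
the external positions, which have weight one. -/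
theorem finrank_ker_forms_le {i : ℕ} (hi : 1 ≤ i) :
    Module.finrank ℝ (Matrix.of fun p : {p | G.formWeight μ p ≤ i} =>
        G.formVec p.1).mulVecLin.ker ≤
      Module.finrank ℝ (G.incidence μ i).mulVecLin.ker := by
  set A := Matrix.of fun p : {p | G.formWeight μ p ≤ i} => G.formVec p.1 with hA
  let φ : (Fin n × Fin 3 → ℝ) →ₗ[ℝ] ({l // l ∈ highLines μ i} → ℝ) :=
    Matrix.mulVecLin (Matrix.of fun l j => (posCoeff (G.src l.1) j : ℝ))
  have hφ : ∀ y l, φ y l = posForm y (G.src l.1) := fun _ _ => rfl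
  have hshort : ∀ y ∈ A.mulVecLin.ker, ∀ l, posForm y (G.src l) = posForm y (G.tgt l) := by
    intro y hy l
    have h := congrFun (LinearMap.mem_ker.1 hy) ⟨.inl l, Nat.zero_le _⟩
    exact sub_eq_zero.1 ((formVec_mulVec_short y l).symm.trans h)
  have hext : ∀ y ∈ A.mulVecLin.ker, ∀ f ∈ G.externals, posForm y f = 0 := fun y hy f hf =>
    congrFun (LinearMap.mem_ker.1 hy) ⟨.inr (.inr ⟨f, hf⟩), hi⟩
  have hlow : ∀ y ∈ A.mulVecLin.ker, ∀ l, l ∉ highLines μ i → posForm y (G.src l) = 0 := by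
    intro y hy l hl
    rw [mem_highLines, not_le] at hl
    have h := congrFun (LinearMap.mem_ker.1 hy) ⟨.inr (.inl l), hl⟩
    have h1 := (formVec_mulVec_long y l).symm.trans h
    have h2 := hshort y hy l
    simp only [Pi.zero_apply] at h1
    linarith
  have hmaps : ∀ y ∈ A.mulVecLin.ker, φ y ∈ (G.incidence μ i).mulVecLin.ker := by
    intro y hy
    rw [LinearMap.mem_ker]
    funext v
    have hpos : ∀ f, posForm y f = G.endSum 1 (fun l => posForm y (G.src l)) f := by
      intro f
      rcases field_cases (G := G) f with ⟨l, rfl⟩ | ⟨l, rfl⟩ | hf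
      · rw [endSum_src]
      · rw [endSum_tgt, hshort y hy, one_mul]
      · rw [endSum_external _ _ _ hf, hext y hy f hf]
    have hsum := sum_alternating_posForm y v
    have h1 : ∑ a : Fin 4, (-1 : ℝ) ^ (a : ℕ) * posForm y (v, a) =
        ∑ f : Fin n × Fin 4, G.endSum 1 (fun l => posForm y (G.src l)) f *
          (if f.1 = v then (-1 : ℝ) ^ (f.2 : ℕ) else 0) := by
      rw [Fintype.sum_prod_type, Finset.sum_eq_single v]
      · simp [← hpos, mul_comm]
      · intro w _ hw
        simp [hw]
      · simp
    rw [h1, sum_endSum_mul] at hsum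
    simp only [Matrix.mulVecLin_apply, Matrix.mulVec, dotProduct, hφ, incidence, Pi.zero_apply]
    refine Eq.trans ?_ hsum
    rw [Finset.sum_coe_sort (highLines μ i) (fun l =>
      ((if (G.src l).1 = v then (-1 : ℝ) ^ ((G.src l).2 : ℕ) else 0) +
        (if (G.tgt l).1 = v then (-1 : ℝ) ^ ((G.tgt l).2 : ℕ) else 0)) * posForm y (G.src l))]
    rw [← Finset.sum_subset (Finset.subset_univ (highLines μ i))]
    · exact Finset.sum_congr rfl fun l _ => by ring
    · intro l _ hl
      rw [hlow y hy l hl, zero_mul]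
  refine LinearMap.finrank_le_finrank_of_injective (f := φ.restrict hmaps) ?_
  rw [← LinearMap.ker_eq_bot, LinearMap.ker_eq_bot']
  rintro ⟨y, hy⟩ h
  have hsrc : ∀ l, posForm y (G.src l) = 0 := by
    intro l
    by_cases hl : l ∈ highLines μ i
    · exact congrFun (congrArg Subtype.val h) ⟨l, hl⟩
    · exact hlow y hy l hl
  refine Subtype.ext (eq_zero_of_posForm fun f => ?_)
  rcases field_cases (G := G) f with ⟨l, rfl⟩ | ⟨l, rfl⟩ | hf
  · exact hsrc l
  · rw [← hshort y hy, hsrc]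
  · exact hext y hy f hf

open Classical in
/-- One can choose `3 n` independent forms among which are all short variables and, at each
scale, few long variables. -/
theorem exists_good_forms (hG : G.Connected) (hext : G.externals.Nonempty) :
    ∃ b : Finset G.Form, b.card = 3 * n ∧ LinearIndependent ℝ (fun p : b => G.formVec p) ∧
      (∀ l, .inl l ∈ b) ∧ ∀ i, 1 ≤ i →
        n + ((highLines μ i).filter fun l => .inr (.inl l) ∈ b).card ≤ (highLines μ i).card +
          (Finset.univ.filter fun k : G.Component μ i => k.IsOrientable).card := by
  have h0 : LinearIndepOn ℝ G.formVec {p | G.formWeight μ p = 0} := by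
    have h1 : {p | G.formWeight μ p = 0} = Set.range (Sum.inl : Fin m → G.Form) := by
      ext p
      rcases p with l | l | f <;> simp [formWeight]
    rw [h1, linearIndepOn_range_iff Sum.inl_injective]
    exact linearIndependent_short hG hext
  obtain ⟨b, hli, h0b, hspan⟩ := exists_greedy_linearIndepOn G.formVec (G.formWeight μ) h0
  -- Long forms have weight `μ l + 1`, so weight at most `i` means scale below `i`. The chosen forms
  -- of this weight span all of them, and rank-nullity applies.
  have hcard : ∀ i, 1 ≤ i → (b ∩ {p | G.formWeight μ p ≤ i}).toFinset.card +
      Module.finrank ℝ (Matrix.of fun p : {p | G.formWeight μ p ≤ i} =>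
        G.formVec p.1).mulVecLin.ker = 3 * n := by
    intro i hi
    have h1 := finrank_span_add_finrank_ker G.formVec {p | G.formWeight μ p ≤ i}
    rw [← hspan i] at h1
    have h2 : LinearIndependent ℝ
        (fun p : ↥(b ∩ {p | G.formWeight μ p ≤ i}) => G.formVec p) :=
      hli.mono Set.inter_subset_left
    have h3 := finrank_span_eq_card h2
    rw [show Set.range (fun p : ↥(b ∩ {p | G.formWeight μ p ≤ i}) => G.formVec p) =
      G.formVec '' (b ∩ {p | G.formWeight μ p ≤ i}) by ext; simp] at h3
    rw [h3] at h1
    rw [Set.toFinset_card, h1]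
    simp [mul_comm]
  have htop : b.toFinset.card = 3 * n := by
    -- At this level every form is admitted and no high line remains, so the common kernel is zero
    -- and `b` is a basis.
    set t := Finset.univ.sup μ + 1 with ht
    have h1 := hcard t (by omega)
    have h2 : b ∩ {p | G.formWeight μ p ≤ t} = b := by
      refine Set.inter_eq_left.2 fun p _ => ?_
      rcases p with l | l | f
      · exact Nat.zero_le _
      · exact Nat.succ_le_succ (Finset.le_sup (Finset.mem_univ l))
      · exact Nat.succ_le_succ (Nat.zero_le _)
    have h3 : highLines μ t = ∅ := by
      refine Finset.eq_empty_of_forall_notMem fun l hl => ?_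
      have := Finset.le_sup (f := μ) (Finset.mem_univ l)
      rw [mem_highLines] at hl
      omega
    have h4 := finrank_ker_forms_le (G := G) μ (i := t) (by omega)
    have h5 := LinearMap.finrank_range_add_finrank_ker (G.incidence μ t).mulVecLin
    rw [Module.finrank_fintype_fun_eq_card, Fintype.card_coe] at h5
    have h6 := congrArg Finset.card h3
    rw [Finset.card_empty] at h6
    simp only [h2] at h1
    omega
  refine ⟨b.toFinset, htop, ?_, fun l => Set.mem_toFinset.2 (h0b rfl), fun i hi => ?_⟩
  · have : LinearIndepOn ℝ G.formVec (b.toFinset : Set G.Form) := by rwa [Set.coe_toFinset]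
    exact this
  · have h1 := hcard i hi
    have h2 := finrank_ker_forms_le (G := G) μ hi
    have h3 := card_add_finrank_ker_incidence_le (G := G) μ i
    -- Chosen long forms of scale at least `i` have weight above `i`; as `b` has `3 n` elements,
    -- their number is at most the dimension of the kernel.
    have h4 : (b ∩ {p | G.formWeight μ p ≤ i}).toFinset.card +
        ((highLines μ i).filter fun l => .inr (.inl l) ∈ b.toFinset).card ≤ b.toFinset.card := by
      rw [← Finset.card_image_of_injective ((highLines μ i).filter _)
        (f := fun l => (.inr (.inl l) : G.Form)) (fun _ _ h => Sum.inl_injective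
          (Sum.inr_injective h)), ← Finset.card_union_of_disjoint]
      · refine Finset.card_le_card fun p hp => ?_
        simp only [Finset.mem_union, Set.mem_toFinset, Finset.mem_image, Finset.mem_filter] at hp ⊢
        rcases hp with hp | ⟨l, hl, rfl⟩
        · exact hp.1
        · exact hl.2
      · rw [Finset.disjoint_left]
        intro p hp hp'
        obtain ⟨l, hl, rfl⟩ := Finset.mem_image.1 hp'
        have h5 : G.formWeight μ (.inr (.inl l)) ≤ i := (Set.mem_toFinset.1 hp).2
        have h6 := mem_highLines.1 (Finset.mem_filter.1 hl).1
        simp only [formWeight] at h5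
        omega
    omega

end Graph

/-! ### Integration of the majorant and collection of the powers of `M`. -/

theorem prod_zpow_eq_zpow_sum {ι : Type*} (s : Finset ι) {M : ℝ} (hM : M ≠ 0) (f : ι → ℤ) :
    ∏ i ∈ s, M ^ f i = M ^ ∑ i ∈ s, f i := by
  classical
  induction s using Finset.induction_on with
  | empty => simp
  | insert a s ha ih => rw [Finset.prod_insert ha, Finset.sum_insert ha, ih, zpow_add₀ hM]

namespace Graph

variable {n m : ℕ} (G : Graph n m)

theorem positions_eq_sum (y : Fin n → Fin 3 → Pos) (f : Fin n × Fin 4) :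
    positions y f.1 f.2 = ∑ j, posCoeff f j • y j.1 j.2 := by
  rw [sum_posCoeff_smul f fun j => y j.1 j.2]
  rfl

theorem continuous_positions (v : Fin n) (a : Fin 4) :
    Continuous fun y : Fin n → Fin 3 → Pos => positions y v a := by
  simp only [positions_eq_sum _ (v, a)]
  fun_prop

theorem norm_vertexPhase (θ : ℝ) (x : Fin 4 → Pos) : ‖vertexPhase θ x‖ = 1 := by
  rw [vertexPhase, mul_comm, Complex.norm_exp_ofReal_mul_I]

theorem continuous_vertexPhase (θ : ℝ) : Continuous (vertexPhase θ) := by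
  unfold vertexPhase symp
  refine Complex.continuous_exp.comp (continuous_const.mul (Complex.continuous_ofReal.comp ?_))
  refine continuous_finsetSum _ fun a _ => continuous_finsetSum _ fun b _ => ?_
  split_ifs
  · fun_prop
  · exact continuous_const

theorem measurable_integrand (θ Ω μ₀ M : ℝ) (μ : Fin m → ℕ)
    (φ : Fin n × Fin 4 → SchwartzMap Pos ℂ) :
    Measurable fun y : Fin n → Fin 3 → Pos => G.integrand θ Ω μ₀ M μ φ (positions y) := by
  have hpos := fun f : Fin n × Fin 4 => (continuous_positions f.1 f.2).measurable
  refine (Measurable.mul ?_ ?_).mul ?_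
  · refine Finset.measurable_prod _ fun v _ => ?_
    exact ((continuous_vertexPhase θ).comp (continuous_pi fun a => continuous_positions v a)).measurable
  · refine Finset.measurable_prod _ fun l _ => ?_
    have h1 := (hpos (G.src l)).sub (hpos (G.tgt l))
    have h2 := (hpos (G.src l)).add (hpos (G.tgt l))
    have h3 := (measurable_propagator Ω μ₀ M (μ l)).comp (h1.prodMk h2)
    exact Complex.measurable_ofReal.comp h3
  · refine Finset.measurable_prod _ fun f _ => ?_
    exact ((φ f).continuous.measurable).comp (hpos f)

/-- The factors of the majorant of the integrand. -/
noncomputable def majorant (M c C : ℝ) (μ : Fin m → ℕ) : G.Form → Pos → ℝ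
  | .inl l => fun x => Real.exp (-(c * M ^ (2 * μ l)) * ‖x‖ ^ 2)
  | .inr (.inl l) => fun x => Real.exp (-(c * (M ^ (2 * μ l))⁻¹) * ‖x‖ ^ 2)
  | .inr (.inr _) => fun x => C * (1 + ‖x‖) ^ (-5 : ℝ)

/-- The exponent of the power of `M` in the integral of a factor of the majorant. -/
def scaleExp (μ : Fin m → ℕ) : G.Form → ℤ
  | .inl l => -4 * μ l
  | .inr (.inl l) => 4 * μ l
  | .inr (.inr _) => 0

variable {G}

theorem majorant_nonneg {M c C : ℝ} (hC : 0 < C) (μ : Fin m → ℕ) (p : G.Form) (x : Pos) :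
    0 ≤ G.majorant M c C μ p x := by
  rcases p with l | l | f <;> simp only [majorant] <;> positivity

/-- Bound for the suprema of the factors of the majorant, and for their integrals up to the power
of `M`. -/
noncomputable def majorantConst (c C : ℝ) : ℝ :=
  1 + C + C * (∫ x : Pos, (1 + ‖x‖) ^ (-5 : ℝ)) + (Real.pi / c) ^ 2

theorem le_majorantConst {c C : ℝ} (hC : 0 < C) : 1 ≤ majorantConst c C ∧ C ≤ majorantConst c C ∧
    C * (∫ x : Pos, (1 + ‖x‖) ^ (-5 : ℝ)) ≤ majorantConst c C ∧
    (Real.pi / c) ^ 2 ≤ majorantConst c C := by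
  have h1 : 0 ≤ C * (∫ x : Pos, (1 + ‖x‖) ^ (-5 : ℝ)) :=
    mul_nonneg hC.le (integral_nonneg fun x => by positivity)
  have h2 : 0 ≤ (Real.pi / c) ^ 2 := sq_nonneg _
  unfold majorantConst
  refine ⟨?_, ?_, ?_, ?_⟩ <;> linarith

theorem majorant_le {M c C : ℝ} (hM : 1 < M) (hc : 0 < c) (hC : 0 < C) (μ : Fin m → ℕ)
    (p : G.Form) (x : Pos) : G.majorant M c C μ p x ≤ majorantConst c C := by
  have hM0 : 0 < M := by linarith
  obtain ⟨h1, h2, -, -⟩ := le_majorantConst (c := c) hC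
  rcases p with l | l | f
  · refine (Real.exp_le_one_iff.2 ?_).trans h1
    rw [neg_mul, neg_nonpos]; positivity
  · refine (Real.exp_le_one_iff.2 ?_).trans h1
    rw [neg_mul, neg_nonpos]; positivity
  · refine le_trans ?_ h2
    refine mul_le_of_le_one_right hC.le ?_
    exact Real.rpow_le_one_of_one_le_of_nonpos (by simp) (by norm_num)

theorem integrable_japanese : Integrable fun x : Pos => (1 + ‖x‖) ^ (-5 : ℝ) := by
  refine integrable_one_add_norm ?_
  rw [finrank_euclideanSpace_fin]; norm_num

theorem integrable_majorant {M c : ℝ} (C : ℝ) (hM : 1 < M) (hc : 0 < c) (μ : Fin m → ℕ)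
    (p : G.Form) : Integrable (G.majorant M c C μ p) := by
  have hM0 : 0 < M := by linarith
  rcases p with l | l | f
  · exact integrable_gaussian (by positivity)
  · exact integrable_gaussian (by positivity)
  · exact integrable_japanese.const_mul C

theorem integral_majorant_le {M c C : ℝ} (hM : 1 < M) (hc : 0 < c) (hC : 0 < C) (μ : Fin m → ℕ)
    (p : G.Form) :
    ∫ x, G.majorant M c C μ p x ≤ majorantConst c C * M ^ G.scaleExp μ p := by
  have hM0 : 0 < M := by linarith
  obtain ⟨-, -, h3, h4⟩ := le_majorantConst (c := c) hC
  rcases p with l | l | f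
  · simp only [majorant, scaleExp]
    rw [integral_gaussian_four (by positivity)]
    refine le_trans (le_of_eq ?_) (mul_le_mul_of_nonneg_right h4 (by positivity))
    rw [show (-4 * (μ l : ℤ)) = -((4 * μ l : ℕ) : ℤ) by push_cast; ring, zpow_neg, zpow_natCast,
      ← div_div, div_pow _ (M ^ (2 * μ l)), ← pow_mul, div_eq_mul_inv]
    congr 3; ring
  · simp only [majorant, scaleExp]
    rw [integral_gaussian_four (by positivity)]
    refine le_trans (le_of_eq ?_) (mul_le_mul_of_nonneg_right h4 (by positivity))
    rw [show (4 * (μ l : ℤ)) = ((4 * μ l : ℕ) : ℤ) by push_cast; ring, zpow_natCast,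
      ← div_div, div_inv_eq_mul, mul_pow, ← pow_mul]
    congr 2; ring
  · simp only [majorant, scaleExp]
    rw [integral_const_mul, zpow_zero, mul_one]
    exact h3

theorem norm_integrand_le {θ Ω μ₀ M c C C' : ℝ}
    (hprop : ∀ (i : ℕ) (u v : Pos), 0 ≤ propagator Ω μ₀ M i u v ∧
      propagator Ω μ₀ M i u v ≤ C' * M ^ (2 * i) *
        (Real.exp (-(c * M ^ (2 * i)) * ‖u‖ ^ 2) * Real.exp (-(c * (M ^ (2 * i))⁻¹) * ‖v‖ ^ 2)))
    (μ : Fin m → ℕ) (φ : Fin n × Fin 4 → SchwartzMap Pos ℂ)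
    (hφ : ∀ f ∈ G.externals, ∀ x, ‖φ f x‖ ≤ C * (1 + ‖x‖) ^ (-5 : ℝ)) (y : Fin n → Fin 3 → Pos) :
    ‖G.integrand θ Ω μ₀ M μ φ (positions y)‖ ≤ (∏ l, C' * M ^ (2 * μ l)) *
      ∏ p, G.majorant M c C μ p (∑ j, G.formCoeff p j • y j.1 j.2) := by
  rw [integrand, norm_mul, norm_mul, norm_prod, norm_prod, norm_prod,
    Finset.prod_congr rfl fun v _ => norm_vertexPhase θ _, Finset.prod_const_one, one_mul,
    Fintype.prod_sum_type, Fintype.prod_sum_type, ← mul_assoc, ← mul_assoc,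
    ← Finset.prod_mul_distrib, ← Finset.prod_mul_distrib]
  refine mul_le_mul ?_ ?_ (Finset.prod_nonneg fun f _ => norm_nonneg _) ?_
  · refine Finset.prod_le_prod (fun l _ => norm_nonneg _) fun l _ => ?_
    have h := hprop (μ l)
      (positions y (G.src l).1 (G.src l).2 - positions y (G.tgt l).1 (G.tgt l).2)
      (positions y (G.src l).1 (G.src l).2 + positions y (G.tgt l).1 (G.tgt l).2)
    rw [Complex.norm_real, Real.norm_of_nonneg h.1, mul_assoc]
    refine h.2.trans (le_of_eq ?_)
    simp only [majorant, formCoeff, positions_eq_sum, Pi.sub_apply, Pi.add_apply, sub_smul,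
      add_smul, Finset.sum_sub_distrib, Finset.sum_add_distrib]
  · rw [← Finset.prod_coe_sort]
    refine Finset.prod_le_prod (fun f _ => norm_nonneg _) fun f _ => ?_
    refine (hφ f.1 f.2 _).trans (le_of_eq ?_)
    simp only [majorant, formCoeff, positions_eq_sum]
  · refine Finset.prod_nonneg fun l _ => ?_
    have h := hprop (μ l)
      (positions y (G.src l).1 (G.src l).2 - positions y (G.tgt l).1 (G.tgt l).2)
      (positions y (G.src l).1 (G.src l).2 + positions y (G.tgt l).1 (G.tgt l).2)
    refine (h.1.trans h.2).trans (le_of_eq ?_)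
    simp only [majorant, formCoeff, positions_eq_sum, Pi.sub_apply, Pi.add_apply, sub_smul,
      add_smul, Finset.sum_sub_distrib, Finset.sum_add_distrib]
    ring

/-- The integral of the majorant, estimated through an independent set of forms. -/
theorem integral_prod_majorant_le {M c C : ℝ} (hM : 1 < M) (hc : 0 < c) (hC : 0 < C)
    (μ : Fin m → ℕ) (b : Finset G.Form) (hb : b.card = 3 * n)
    (hli : LinearIndependent ℝ (fun p : b => G.formVec p)) :
    ∃ F : (Fin n → Fin 3 → Pos) → ℝ, Integrable F ∧
      (∀ y, ∏ p, G.majorant M c C μ p (∑ j, G.formCoeff p j • y j.1 j.2) ≤ F y) ∧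
      ∫ y, F y ≤ majorantConst c C ^ (7 * n) * M ^ ∑ p ∈ b, G.scaleExp μ p := by
  classical
  have hM0 : 0 < M := by linarith
  set D := majorantConst c C with hD
  have hD1 : 1 ≤ D := (le_majorantConst hC).1
  let e : Fin n × Fin 3 ≃ b := Fintype.equivOfCardEq (by simp [hb, mul_comm])
  set A : Matrix (Fin n × Fin 3) (Fin n × Fin 3) ℤ := fun p j => G.formCoeff (e p).1 j with hA
  have hdet : A.det ≠ 0 := by
    have h1 : LinearIndependent ℝ (A.map (Int.cast : ℤ → ℝ)).row := hli.comp e e.injective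
    have h2 := (Matrix.isUnit_iff_isUnit_det _).1 (Matrix.linearIndependent_rows_iff_isUnit.1 h1)
    intro h
    have h3 := (Int.castRingHom ℝ).map_det A
    rw [h, map_zero] at h3
    exact h2.ne_zero h3.symm
  obtain ⟨hint, hle⟩ := integral_prod_intForms_le A hdet (fun p => G.majorant M c C μ (e p).1)
    (fun p => integrable_majorant C hM hc μ _) (fun p x => majorant_nonneg hC μ _ x)
  -- Each factor outside `b` is at most `D`, and there are `4 n` forms in all.
  refine ⟨_, hint.const_mul (D ^ (4 * n)), fun y => ?_, ?_⟩
  · have h1 : ∏ p, G.majorant M c C μ (e p).1 (∑ j, A p j • y j.1 j.2) =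
        ∏ p ∈ b, G.majorant M c C μ p (∑ j, G.formCoeff p j • y j.1 j.2) := by
      rw [← Finset.prod_coe_sort b]
      exact Fintype.prod_equiv e _ _ fun p => rfl
    rw [h1, ← Finset.prod_compl_mul_prod b]
    refine mul_le_mul_of_nonneg_right ?_ (Finset.prod_nonneg fun p _ => majorant_nonneg hC μ p _)
    calc ∏ p ∈ bᶜ, G.majorant M c C μ p (∑ j, G.formCoeff p j • y j.1 j.2)
        ≤ ∏ p ∈ bᶜ, D := Finset.prod_le_prod (fun p _ => majorant_nonneg hC μ p _)
          fun p _ => majorant_le hM hc hC μ p _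
      _ = D ^ (bᶜ).card := Finset.prod_const _
      _ ≤ D ^ (4 * n) := by
        refine pow_le_pow_right₀ hD1 ?_
        rw [← G.card_form]
        exact Finset.card_le_univ _
  · rw [integral_const_mul]
    have h2 : ∏ p, ∫ x, G.majorant M c C μ (e p).1 x ≤ D ^ (3 * n) * M ^ ∑ p ∈ b, G.scaleExp μ p := by
      have h3 : ∏ p, ∫ x, G.majorant M c C μ (e p).1 x =
          ∏ p ∈ b, ∫ x, G.majorant M c C μ p x := by
        rw [← Finset.prod_coe_sort b]
        exact Fintype.prod_equiv e _ _ fun p => rfl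
      rw [h3, ← prod_zpow_eq_zpow_sum b hM0.ne', ← hb, ← Finset.prod_const, ← Finset.prod_mul_distrib]
      exact Finset.prod_le_prod (fun p _ => integral_nonneg fun x => majorant_nonneg hC μ p x)
        fun p _ => integral_majorant_le hM hc hC μ p
    calc _ ≤ D ^ (4 * n) * (D ^ (3 * n) * M ^ ∑ p ∈ b, G.scaleExp μ p) := by
          refine mul_le_mul_of_nonneg_left (hle.trans h2) (by positivity)
      _ = _ := by rw [← mul_assoc, ← pow_add]; congr 2; ring

/-- A scale `μ l` is the number of `i ≥ 1` with `i ≤ μ l`; exchange the sums. -/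
theorem sum_scale_eq (μ : Fin m → ℕ) (P : Fin m → Prop) [DecidablePred P] :
    ∑ l, (if P l then (μ l : ℤ) else 0) =
      ∑ i ∈ Finset.Icc 1 (Finset.univ.sup μ), (((highLines μ i).filter P).card : ℤ) := by
  have h1 : ∀ i, (((highLines μ i).filter P).card : ℤ) =
      ∑ l, if P l then (if i ≤ μ l then 1 else 0) else 0 := by
    intro i
    rw [highLines, Finset.filter_filter, Finset.card_filter]
    push_cast
    refine Finset.sum_congr rfl fun l _ => ?_
    by_cases h : P l <;> simp [h]
  simp only [h1]
  rw [Finset.sum_comm]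
  refine Finset.sum_congr rfl fun l _ => ?_
  by_cases h : P l
  · simp only [h, if_true]
    rw [Finset.sum_boole]
    have h2 : (Finset.Icc 1 (Finset.univ.sup μ)).filter (fun i => i ≤ μ l) = Finset.Icc 1 (μ l) := by
      ext i
      have := Finset.le_sup (f := μ) (Finset.mem_univ l)
      simp only [Finset.mem_filter, Finset.mem_Icc]
      omega
    rw [h2]
    simp
  · simp [h]

/-- Sliced by scale, the exponent at `i` is `2 h - 4 h + 4 L`, with `h` the number of lines of scale
at least `i` and `L` of those whose long form is chosen. Four times `hlong` bounds it by minus the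
sum of the degrees. -/
theorem zpow_le_powerCounting {M : ℝ} (hM : 1 < M) (μ : Fin m → ℕ) (b : Finset G.Form)
    (hshort : ∀ l, .inl l ∈ b)
    (hlong : open Classical in ∀ i, 1 ≤ i →
      n + ((highLines μ i).filter fun l => .inr (.inl l) ∈ b).card ≤ (highLines μ i).card +
        (Finset.univ.filter fun k : G.Component μ i => k.IsOrientable).card) :
    M ^ (∑ l, 2 * (μ l : ℤ) + ∑ p ∈ b, G.scaleExp μ p) ≤ G.powerCounting M μ := by
  classical
  have hM0 : 0 < M := by linarith
  have h1 : G.powerCounting M μ =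
      M ^ ∑ i ∈ Finset.Icc 1 (Finset.univ.sup μ), ∑ k : G.Component μ i, -k.omega := by
    rw [powerCounting, ← prod_zpow_eq_zpow_sum _ hM0.ne']
    exact Finset.prod_congr rfl fun i _ => prod_zpow_eq_zpow_sum _ hM0.ne' _
  rw [h1]
  refine zpow_le_zpow_right₀ hM.le ?_
  have h2 : ∑ p ∈ b, G.scaleExp μ p =
      -4 * ∑ l, (μ l : ℤ) + 4 * ∑ l, (if .inr (.inl l) ∈ b then (μ l : ℤ) else 0) := by
    have h : ∑ p ∈ b, G.scaleExp μ p = ∑ p, if p ∈ b then G.scaleExp μ p else 0 := by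
      rw [Finset.sum_ite_mem, Finset.univ_inter]
    rw [h, Fintype.sum_sum_type, Fintype.sum_sum_type]
    simp [hshort, scaleExp, Finset.mul_sum]
  have h3 := sum_scale_eq μ (fun _ => True)
  simp only [if_true, Finset.filter_true] at h3
  rw [h2, ← Finset.mul_sum, h3, sum_scale_eq μ]
  rw [Finset.mul_sum, Finset.mul_sum, Finset.mul_sum, ← Finset.sum_add_distrib,
    ← Finset.sum_add_distrib]
  refine Finset.sum_le_sum fun i hi => ?_
  rw [Finset.sum_neg_distrib, sum_omega]
  have h4 := hlong i (Finset.mem_Icc.1 hi).1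
  zify at h4
  linarith

end Graph

end NCPhi

/-! ### The power counting theorem. -/

theorem mainTheorem3 (θ Ω μ₀ M : ℝ) (hθ : θ ≠ 0) (hΩ : 0 < Ω) (hM : 1 < M)
    (𝓕 : Set (SchwartzMap NCPhi.Pos ℂ)) (h𝓕 : Bornology.IsVonNBounded ℝ 𝓕) :
    ∃ K : ℝ, 0 < K ∧
      ∀ (n m : ℕ) (G : NCPhi.Graph n m), G.Connected → G.externals.Nonempty →
      ∀ μ : Fin m → ℕ,
        (∀ φ : Fin n × Fin 4 → SchwartzMap NCPhi.Pos ℂ, (∀ f ∈ G.externals, φ f ∈ 𝓕) →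
          MeasureTheory.Integrable (fun y : Fin n → Fin 3 → NCPhi.Pos =>
            G.integrand θ Ω μ₀ M μ φ (NCPhi.Graph.positions y)) ∧
          ‖G.amplitude θ Ω μ₀ M μ φ‖ ≤ K ^ n * G.powerCounting M μ) ∧
        (∀ (i : ℕ) (k : G.Component μ i), ¬ k.IsOrientable → 0 < k.omega) := by
  obtain ⟨C₀, c, hC₀, hc, hprop⟩ := NCPhi.exists_propagator_bound Ω μ₀ M hΩ hM
  obtain ⟨C, hC, hφ⟩ := NCPhi.exists_schwartz_bound 𝓕 h𝓕
  have hM0 : 0 < M := by linarith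
  -- A constant at least one is needed to replace its power `m` by `2 n`, since `m ≤ 2 n`.
  set C' := max 1 C₀ with hC'
  have hC'1 : 1 ≤ C' := le_max_left _ _
  set D := NCPhi.Graph.majorantConst c C with hD
  have hD1 : 1 ≤ D := (NCPhi.Graph.le_majorantConst hC).1
  refine ⟨C' ^ 2 * D ^ 7, by positivity, fun n m G hG hext μ =>
    ⟨fun φ hφ𝓕 => ?_, fun i k hk => k.omega_pos hG hext hk⟩⟩
  have hprop' : ∀ (i : ℕ) (u v : NCPhi.Pos), 0 ≤ NCPhi.propagator Ω μ₀ M i u v ∧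
      NCPhi.propagator Ω μ₀ M i u v ≤ C' * M ^ (2 * i) *
        (Real.exp (-(c * M ^ (2 * i)) * ‖u‖ ^ 2) *
          Real.exp (-(c * (M ^ (2 * i))⁻¹) * ‖v‖ ^ 2)) := by
    intro i u v
    refine ⟨(hprop i u v).1, (hprop i u v).2.trans ?_⟩
    gcongr
    exact le_max_right _ _
  obtain ⟨b, hbcard, hbli, hbshort, hblong⟩ := NCPhi.Graph.exists_good_forms μ hG hext
  obtain ⟨F, hFint, hFle, hFval⟩ :=
    NCPhi.Graph.integral_prod_majorant_le hM hc hC μ b hbcard hbli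
  set P : ℝ := ∏ l, C' * M ^ (2 * μ l) with hP
  have hP0 : 0 ≤ P := Finset.prod_nonneg fun l _ => by positivity
  have hbound : ∀ y : Fin n → Fin 3 → NCPhi.Pos,
      ‖G.integrand θ Ω μ₀ M μ φ (NCPhi.Graph.positions y)‖ ≤ P * F y := fun y =>
    (NCPhi.Graph.norm_integrand_le hprop' μ φ (fun f hf => hφ _ (hφ𝓕 f hf)) y).trans
      (mul_le_mul_of_nonneg_left (hFle y) hP0)
  have hint := hFint.const_mul P
  refine ⟨hint.mono' (G.measurable_integrand θ Ω μ₀ M μ φ).aestronglyMeasurable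
    (MeasureTheory.ae_of_all _ hbound), ?_⟩
  have hm : m ≤ 2 * n := by
    have h := G.card_form
    rw [Fintype.card_sum, Fintype.card_sum, Fintype.card_fin] at h
    omega
  have hPle : P ≤ C' ^ (2 * n) * M ^ ∑ l, 2 * (μ l : ℤ) := by
    rw [hP, Finset.prod_mul_distrib, Finset.prod_const, Finset.card_univ, Fintype.card_fin,
      ← NCPhi.prod_zpow_eq_zpow_sum _ hM0.ne']
    refine mul_le_mul (pow_le_pow_right₀ hC'1 hm) (le_of_eq ?_) (by positivity) (by positivity)
    exact Finset.prod_congr rfl fun l _ => by rw [← zpow_natCast]; push_cast; rfl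
  calc ‖G.amplitude θ Ω μ₀ M μ φ‖ ≤ ∫ y, P * F y :=
        MeasureTheory.norm_integral_le_of_norm_le hint (MeasureTheory.ae_of_all _ hbound)
    _ = P * ∫ y, F y := MeasureTheory.integral_const_mul _ _
    _ ≤ (C' ^ (2 * n) * M ^ ∑ l, 2 * (μ l : ℤ)) *
        (D ^ (7 * n) * M ^ ∑ p ∈ b, G.scaleExp μ p) := by
        refine (mul_le_mul_of_nonneg_left hFval hP0).trans ?_
        exact mul_le_mul_of_nonneg_right hPle (by positivity)
    _ = (C' ^ 2 * D ^ 7) ^ n *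
        M ^ (∑ l, 2 * (μ l : ℤ) + ∑ p ∈ b, G.scaleExp μ p) := by
        rw [zpow_add₀ hM0.ne', mul_pow, ← pow_mul, ← pow_mul]; ring
    _ ≤ (C' ^ 2 * D ^ 7) ^ n * G.powerCounting M μ := by
        refine mul_le_mul_of_nonneg_left ?_ (by positivity)
        exact NCPhi.Graph.zpow_le_powerCounting hM μ b hbshort hblong
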